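/- Let $k$ be a field. All gradings are by $\mathbb{Z}$, differentials have degree $-1$, and permuting homogeneous factors introduces the Koszul sign. A \emph{(dg) $\mathbb{S}$-module} is a functor from finite sets and bijections to (differential) graded $k$-modules. The composition product of two $\mathbb{S}$-modules is $$(A\circ B)(X)=\bigoplus_{r\ge 0}A(\{1,\dots,r\})\otimes_{\mathbb{S}_r}\Bigl(\bigoplus_{X=X_1\amalg\dots\amalg X_r}B(X_1)\otimes\dots\otimes B(X_r)\Bigr),$$ the sum being over decompositions into $r$ possibly empty blocks. It has the unit $I$, with $I(X)=k$ in degree $0$ if $|X|=1$ and $I(X)=0$ otherwise. For morphisms $\varphi:A\to A'$, $\eta,\theta:B\to B'$ with $\eta$ of degree $0$, let $\varphi\circ(\eta;\theta):A\circ B\to A'\circ B'$ be the sum, over $j=1,\dots,r$, of the maps that apply $\varphi$ to the factor in $A$, $\theta$ to the $j$-th factor in $B$ and $\eta$ to all other factors in $B$. For dg $\mathbb{S}$-modules put $d_{A\circ B}=d_A\circ\mathrm{id}+\mathrm{id}\circ(\mathrm{id};d_B)$. An \emph{operad} $(O,\mu_O,u_O)$ is a monoid, and a \emph{cooperad} $(C,\Delta_C,\varepsilon_C)$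 a comonoid, in the monoidal category of dg $\mathbb{S}$-modules with the product $\circ$. A \emph{right $C$-comodule} is a dg $\mathbb{S}$-module $M$ with a coassociative and counital chain map $\Delta_M:M\to M\circ C$. An \emph{$\mathbb{S}$-module-algebra} over $O$ is a dg $\mathbb{S}$-module $A$ with a chain map $\mu_A:O\circ A\to A$ such that $\mu_A(\mu_O\circ\mathrm{id})=\mu_A(\mathrm{id}\circ\mu_A)$ (unitality is not required). A \emph{twisting morphism} is a map of $\mathbb{S}$-modules $\kappa:C\to O$ of degree $-1$ with $d_O\kappa+\kappa d_C+\kappa*\kappa=0$, where $\kappa*\kappa=\mu_O\,(\kappa\circ(u_O\varepsilon_C;\kappa))\,\Delta_C$. For a twisting morphism $\kappa:C\to O$, a right $C$-comodule $M$ and an $\mathbb{S}$-module-algebra $A$ over $O$, let $d_\kappa$ be the endomorphism of degree $-1$ of $M\circ A$ given by $$M\circ A\xrightarrow{\Delta_M\circ\mathrm{id}}(M\circ C)\circ A\cong M\circ(C\circ A)\xrightarrow{\mathrm{id}\circ(\eta;\theta)}M\circ A,$$ where $\eta:C\circ A\xrightarrow{\varepsilon_C\circ\mathrm{id}}I\circ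 A\cong A$ and $\theta:C\circ A\xrightarrow{\kappa\circ\mathrm{id}}O\circ A\xrightarrow{\mu_A}A$. The \emph{twisted composite} $M\circ_\kappa A$ is the graded $\mathbb{S}$-module $M\circ A$ with the degree $-1$ endomorphism $d_\kappa+d_{M\circ A}$. \textbf{Lemma.} Let $f:O\to P$ be a morphism of operads, $g:C\to D$ a morphism of cooperads, and $\kappa:C\to O$, $\kappa':D\to P$ twisting morphisms with $f\kappa=\kappa'g$. Let $M$ be a right $C$-comodule and $A$ an $\mathbb{S}$-module-algebra over $P$. Write $g^*M$ for the right $D$-comodule $M$ with the coaction $(\mathrm{id}\circ g)\Delta_M$, and $f^*A$ for the $\mathbb{S}$-module-algebra $A$ over $O$ with the action $\mu_A(f\circ\mathrm{id})$. Then there is an isomorphism $$M\circ_\kappa f^*A\;\cong\;g^*M\circ_{\kappa'}A$$ of graded $\mathbb{S}$-modules that commutes with the given endomorphisms of degree $-1$, and whose underlying map is the identity of $M\circ A$. -/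

import Mathlib

universe u

noncomputable section

open scoped TensorProduct DirectSum

/-! ### Graded symmetric modules -/

/-- A graded `𝕊`-module: a functor from finite sets and bijections to `ℤ`-graded `k`-modules.
The action of a bijection takes an equation between degrees as an extra argument, so that degrees
can be rewritten without casts. -/
structure GSMod (k : Type u) [Field k] where
  obj : (X : Type) → [Finite X] → ℤ → Type u
  [instAdd : ∀ (X : Type) [Finite X] (n : ℤ), AddCommGroup (obj X n)]
  [instMod : ∀ (X : Type) [Finite X] (n : ℤ), Module k (obj X n)]
  map : ∀ {X Y : Type} [Finite X] [Finite Y] (_ : X ≃ Y) {n m : ℤ} (_ : n = m),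
    obj X n →ₗ[k] obj Y m
  map_refl : ∀ {X : Type} [Finite X] {n : ℤ} (x : obj X n), map (Equiv.refl X) rfl x = x
  map_map : ∀ {X Y Z : Type} [Finite X] [Finite Y] [Finite Z] (e : X ≃ Y) (e' : Y ≃ Z)
    {n m l : ℤ} (h : n = m) (h' : m = l) (x : obj X n),
    map e' h' (map e h x) = map (e.trans e') (h.trans h') x

attribute [instance] GSMod.instAdd GSMod.instMod

variable {k : Type u} [Field k]

/-- Morphisms of graded `𝕊`-modules of degree `t`. -/
@[ext] structure GHom (t : ℤ) (A B : GSMod k) where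
  app : ∀ {X : Type} [Finite X] {n m : ℤ} (_ : m = n + t), A.obj X n →ₗ[k] B.obj X m
  naturality : ∀ {X Y : Type} [Finite X] [Finite Y] (e : X ≃ Y) {n m n' m' : ℤ} (h : m = n + t)
    (h' : m' = n' + t) (hn : n = n') (hm : m = m') (x : A.obj X n),
    B.map e hm (app h x) = app h' (A.map e hn x)

namespace GHom

/-- The identity. -/
def id (A : GSMod k) : GHom 0 A A where
  app h := A.map (Equiv.refl _) (by omega)
  naturality e _ _ _ _ h h' hn hm x := by simp only [A.map_map]; rfl

/-- The composite. -/
def comp {A B C : GSMod k} {s t r : ℤ} (g : GHom t B C) (f : GHom s A B)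
    (hr : r = s + t := by omega) : GHom r A C where
  app {_ _ n _} h := (g.app (n := n + s) (by omega)).comp (f.app rfl)
  naturality e _ _ _ _ h h' hn hm x := by
    subst hn
    simp only [LinearMap.comp_apply]
    rw [g.naturality e _ _ rfl hm, f.naturality e _ _ rfl rfl]

instance {A B : GSMod k} {t : ℤ} : Add (GHom t A B) where
  add f g :=
    { app := fun h => f.app h + g.app h
      naturality := fun e _ _ _ _ h h' hn hm x => by
        simp only [LinearMap.add_apply, map_add]
        rw [f.naturality e h h' hn hm, g.naturality e h h' hn hm] }

instance {A B : GSMod k} {t : ℤ} : Zero (GHom t A B) where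
  zero :=
    { app := fun _ => 0
      naturality := fun _ _ _ _ _ _ _ _ _ _ => by simp }

end GHom

/-! ### The composition product -/

/-- The exponent of the Koszul sign of the permutation `σ` of homogeneous factors of degrees `q`:
each inversion `i < j`, `σ j < σ i` contributes `q i * q j`. -/
def koszulExp {ι ι' : Type} [Fintype ι] [LinearOrder ι] [LinearOrder ι'] (σ : ι ≃ ι')
    (q : ι → ℤ) : ℤ :=
  ∑ i, ∑ j, if i < j ∧ σ j < σ i then q i * q j else 0

/-- The index set of the summands of the degree `n` part of `(A ∘ B)(X)`: a number `r`, a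
decomposition of `X` into `r` (possibly empty) blocks, given by the map `f` sending a point to the
number of its block, and degrees `p` and `q 1, …, q r` with sum `n`. -/
structure CompIdx (X : Type) (n : ℤ) where
  r : ℕ
  f : X → Fin r
  p : ℤ
  q : Fin r → ℤ
  deg : p + ∑ i, q i = n

/-- The summand `A({1, …, r}) ⊗ B(X₁) ⊗ ⋯ ⊗ B(X_r)` with `X = X₁ ⨿ ⋯ ⨿ X_r`. -/
abbrev CompSummand (A B : GSMod k) {X : Type} [Finite X] {n : ℤ} (i : CompIdx X n) : Type u :=
  A.obj (Fin i.r) i.p ⊗[k] (⨂[k] j, B.obj {x // i.f x = j} (i.q j))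

open Classical in
/-- The direct sum of all `A({1, …, r}) ⊗ B(X₁) ⊗ ⋯ ⊗ B(X_r)` with `X = X₁ ⨿ ⋯ ⨿ X_r`, in
degree `n`, before passing to coinvariants. -/
abbrev CompRaw (A B : GSMod k) (X : Type) [Finite X] (n : ℤ) : Type u :=
  ⨁ i : CompIdx X n, CompSummand A B i

open Classical in
/-- The inclusion of a summand. -/
def rawIncl (A B : GSMod k) {X : Type} [Finite X] {n : ℤ} (i : CompIdx X n) :
    CompSummand A B i →ₗ[k] CompRaw A B X n :=
  DirectSum.lof k (CompIdx X n) (fun i => CompSummand A B i) i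

/-- The generator `a ⊗ b₁ ⊗ ⋯ ⊗ b_r`. -/
def pureTensor {A B : GSMod k} {X : Type} [Finite X] {n : ℤ} (i : CompIdx X n)
    (a : A.obj (Fin i.r) i.p) (b : ∀ j, B.obj {x // i.f x = j} (i.q j)) : CompSummand A B i :=
  a ⊗ₜ PiTensorProduct.tprod k b

/-- If `f' = σ ∘ f`, the block of `f` at `j` is the block of `f'` at `σ j`. -/
def blockPerm {X Y Y' : Type} {f : X → Y} {f' : X → Y'} (σ : Y ≃ Y')
    (h : ∀ x, f' x = σ (f x)) (j : Y) : {x // f x = j} ≃ {x // f' x = σ j} :=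
  Equiv.subtypeEquivRight fun x => by rw [h]; exact σ.apply_eq_iff_eq.symm

/-- The summand `i'` is obtained from `i` by renumbering the blocks by `σ`. -/
structure IsRenumbering {X : Type} {n : ℤ} (i i' : CompIdx X n) (σ : Fin i.r ≃ Fin i'.r) :
    Prop where
  f : ∀ x, i'.f x = σ (i.f x)
  p : i.p = i'.p
  q : ∀ j, i.q j = i'.q (σ j)

/-- The generator `a' ⊗ b'₁ ⊗ ⋯ ⊗ b'_r` is obtained from `a ⊗ b₁ ⊗ ⋯ ⊗ b_r` by the permutation
`σ`, that is, `a' = σ a` and `b'_{σ j} = b_j`. -/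
def IsPermuted {A B : GSMod k} {X : Type} [Finite X] {n : ℤ} {i i' : CompIdx X n}
    {σ : Fin i.r ≃ Fin i'.r} (h : IsRenumbering i i' σ)
    (a : A.obj (Fin i.r) i.p) (b : ∀ j, B.obj {x // i.f x = j} (i.q j))
    (a' : A.obj (Fin i'.r) i'.p) (b' : ∀ j, B.obj {x // i'.f x = j} (i'.q j)) : Prop :=
  a' = A.map σ h.p a ∧ ∀ j, b' (σ j) = B.map (blockPerm σ h.f j) (h.q j) (b j)

/-- The relations dividing out the diagonal action of the symmetric groups, which permutes the
factors `b₁, …, b_r` with the Koszul sign. -/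
def compRel (A B : GSMod k) (X : Type) [Finite X] (n : ℤ) : Submodule k (CompRaw A B X n) :=
  Submodule.span k {z | ∃ (i i' : CompIdx X n) (σ : Fin i.r ≃ Fin i'.r)
    (h : IsRenumbering i i' σ) (a : A.obj (Fin i.r) i.p)
    (b : ∀ j, B.obj {x // i.f x = j} (i.q j)) (a' : A.obj (Fin i'.r) i'.p)
    (b' : ∀ j, B.obj {x // i'.f x = j} (i'.q j)), IsPermuted h a b a' b' ∧
    z = rawIncl A B i' (pureTensor i' a' b')
        - (-1 : k) ^ koszulExp σ i.q • rawIncl A B i (pureTensor i a b)}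

/-- The degree `n` part of `(A ∘ B)(X)`. -/
abbrev CompObj (A B : GSMod k) (X : Type) [Finite X] (n : ℤ) : Type u :=
  CompRaw A B X n ⧸ compRel A B X n

section compAPI

variable {A B : GSMod k} {X : Type} [Finite X] {n : ℤ}

/-- The map from a summand to the coinvariants. -/
def compIncl (i : CompIdx X n) : CompSummand A B i →ₗ[k] CompObj A B X n :=
  (compRel A B X n).mkQ.comp (rawIncl A B i)

/-- The class of `a ⊗ b₁ ⊗ ⋯ ⊗ b_r` in `A ∘ B`. -/
def compMk (i : CompIdx X n) (a : A.obj (Fin i.r) i.p)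
    (b : ∀ j, B.obj {x // i.f x = j} (i.q j)) : CompObj A B X n :=
  compIncl i (pureTensor i a b)

theorem compMk_perm {i i' : CompIdx X n} {σ : Fin i.r ≃ Fin i'.r} (h : IsRenumbering i i' σ)
    {a : A.obj (Fin i.r) i.p} {b : ∀ j, B.obj {x // i.f x = j} (i.q j)}
    {a' : A.obj (Fin i'.r) i'.p} {b' : ∀ j, B.obj {x // i'.f x = j} (i'.q j)}
    (hab : IsPermuted h a b a' b') :
    compMk i' a' b' = (-1 : k) ^ koszulExp σ i.q • compMk i a b := by
  rw [← sub_eq_zero]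
  exact (Submodule.Quotient.mk_eq_zero _).2 (Submodule.subset_span ⟨i, i', σ, h, a, b, a', b', hab, rfl⟩)

/-- Compatibility of a family of linear maps on the summands with the symmetric group actions. -/
abbrev CompatPerm {W : Type u} [AddCommGroup W] [Module k W]
    (F : ∀ i : CompIdx X n, CompSummand A B i →ₗ[k] W) : Prop :=
  ∀ (i i' : CompIdx X n) (σ : Fin i.r ≃ Fin i'.r) (h : IsRenumbering i i' σ)
    (a : A.obj (Fin i.r) i.p) (b : ∀ j, B.obj {x // i.f x = j} (i.q j))
    (a' : A.obj (Fin i'.r) i'.p) (b' : ∀ j, B.obj {x // i'.f x = j} (i'.q j)),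
    IsPermuted h a b a' b' →
      F i' (pureTensor i' a' b') = (-1 : k) ^ koszulExp σ i.q • F i (pureTensor i a b)

open Classical in
/-- The universal property of `A ∘ B`. -/
def compLift {W : Type u} [AddCommGroup W] [Module k W]
    (F : ∀ i : CompIdx X n, CompSummand A B i →ₗ[k] W) (hF : CompatPerm F) :
    CompObj A B X n →ₗ[k] W :=
  (compRel A B X n).liftQ (DirectSum.toModule k _ W F) <| by
    rw [compRel, Submodule.span_le]
    rintro _ ⟨i, i', σ, h, a, b, a', b', hab, rfl⟩
    simp only [SetLike.mem_coe, LinearMap.mem_ker, map_sub, map_smul, rawIncl,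
      DirectSum.toModule_lof]
    rw [sub_eq_zero]
    exact hF i i' σ h a b a' b' hab

section
variable {W : Type u} [AddCommGroup W] [Module k W]

theorem compLift_mk (F : ∀ i : CompIdx X n, CompSummand A B i →ₗ[k] W) (hF : CompatPerm F)
    (i : CompIdx X n) (a : A.obj (Fin i.r) i.p) (b : ∀ j, B.obj {x // i.f x = j} (i.q j)) :
    compLift F hF (compMk i a b) = F i (pureTensor i a b) := by
  simp [compLift, compIncl, compMk, rawIncl]

theorem comp_ext {F G : CompObj A B X n →ₗ[k] W}
    (h : ∀ i a b, F (compMk i a b) = G (compMk i a b)) : F = G := by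
  classical
  apply Submodule.linearMap_qext
  apply DirectSum.linearMap_ext
  intro i
  apply TensorProduct.ext
  ext a b
  exact h i a b

theorem comp_ext_apply (F G : CompObj A B X n →ₗ[k] W)
    (h : ∀ i a b, F (compMk i a b) = G (compMk i a b)) (x : CompObj A B X n) : F x = G x := by
  rw [comp_ext h]

end

theorem koszulExp_eq_zero {ι ι' : Type} [Fintype ι] [LinearOrder ι] [LinearOrder ι'] (σ : ι ≃ ι')
    (q : ι → ℤ) (hσ : StrictMono σ) : koszulExp σ q = 0 :=
  Finset.sum_eq_zero fun i _ => Finset.sum_eq_zero fun j _ =>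
    if_neg fun h => (hσ h.1).not_gt h.2

/-- Equal maps have the same blocks. -/
def blockCongr {X Y : Type} {f f' : X → Y} (h : ∀ x, f' x = f x) (j : Y) :
    {x // f x = j} ≃ {x // f' x = j} :=
  Equiv.subtypeEquivRight fun x => by rw [h]

/-- Two descriptions of the same generator. -/
theorem compMk_congr {r : ℕ} {f f' : X → Fin r} {p p' : ℤ} {q q' : Fin r → ℤ}
    {d : p + ∑ i, q i = n} {d' : p' + ∑ i, q' i = n} (hf : ∀ x, f' x = f x) (hp : p = p')
    (hq : ∀ j, q j = q' j)
    {a : A.obj (Fin r) p} {b : ∀ j, B.obj {x // f x = j} (q j)}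
    {a' : A.obj (Fin r) p'} {b' : ∀ j, B.obj {x // f' x = j} (q' j)}
    (ha : a' = A.map (Equiv.refl _) hp a)
    (hb : ∀ j, b' j = B.map (blockCongr hf j) (hq j) (b j)) :
    compMk (⟨r, f', p', q', d'⟩ : CompIdx X n) a' b' = compMk ⟨r, f, p, q, d⟩ a b := by
  rw [compMk_perm (i := ⟨r, f, p, q, d⟩) (i' := ⟨r, f', p', q', d'⟩) (σ := Equiv.refl _)
    ⟨hf, hp, hq⟩ ⟨ha, hb⟩, koszulExp_eq_zero]
  · simp
  · intro x y h; exact h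

end compAPI

/-! ### Signs -/

theorem negOne_zpow_congr {a b : ℤ} (h : (a : ZMod 2) = b) : (-1 : k) ^ a = (-1 : k) ^ b := by
  have h1 : Even (a - b) := (ZMod.intCast_zmod_eq_zero_iff_dvd (a - b) 2 |>.1 (by
    push_cast; rw [h, sub_self])) |> even_iff_two_dvd.2
  have h2 : (-1 : k) ^ a = (-1 : k) ^ (a - b) * (-1 : k) ^ b := by
    rw [← zpow_add₀ (by simp)]; congr 1; ring
  rw [h2, h1.neg_one_zpow, one_mul]

/-- The Koszul signs of `σ` before and after changing the degree of the factor `j` by `t`. -/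
theorem koszulExp_update {ι ι' : Type} [Fintype ι] [LinearOrder ι] [Fintype ι'] [LinearOrder ι']
    (σ : ι ≃ ι') (q : ι → ℤ) (q' : ι' → ℤ) (hq : ∀ i, q i = q' (σ i)) (j : ι) (t : ℤ) :
    ((koszulExp σ (fun l => q l + if l = j then t else 0) + t * ∑ l with l < σ j, q' l : ℤ) :
      ZMod 2) = ((koszulExp σ q + t * ∑ l with l < j, q l : ℤ) : ZMod 2) := by
  have e1 : ∑ l with l < σ j, q' l = ∑ l, if σ l < σ j then q l else 0 := by
    rw [Finset.sum_filter, ← Equiv.sum_comp σ]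
    simp [hq]
  have e2 : koszulExp σ (fun l => q l + if l = j then t else 0) = koszulExp σ q
      + ∑ l, (if l < j ∧ σ j < σ l then t * q l else 0)
      + ∑ l, (if j < l ∧ σ l < σ j then t * q l else 0) := by
    unfold koszulExp
    have : ∀ i l, (if i < l ∧ σ l < σ i then
        (q i + if i = j then t else 0) * (q l + if l = j then t else 0) else 0)
        = (if i < l ∧ σ l < σ i then q i * q l else 0)
          + (if l = j then (if i < j ∧ σ j < σ i then t * q i else 0) else 0)
          + (if i = j then (if j < l ∧ σ l < σ j then t * q l else 0) else 0) := by
      intro i l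
      by_cases h1 : i = j <;> by_cases h2 : l = j
      · subst h1; subst h2; simp
      · subst h1; simp only [h2, if_true, if_false]; split_ifs <;> ring
      · subst h2; simp only [h1, if_true, if_false]; split_ifs <;> ring
      · simp [h1, h2]
    simp only [this, Finset.sum_add_distrib]
    congr 1
    · congr 1
      simp
    · rw [Finset.sum_comm]; simp
  rw [e1, e2, Finset.sum_filter]
  push_cast
  rw [add_assoc, add_assoc, add_right_inj, Finset.mul_sum, Finset.mul_sum,
    ← Finset.sum_add_distrib, ← Finset.sum_add_distrib]
  refine Finset.sum_congr rfl fun l _ => ?_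
  have two : ∀ x : ZMod 2, x + x = 0 := by decide
  rcases lt_trichotomy l j with h | h | h
  · rcases lt_trichotomy (σ l) (σ j) with h' | h' | h'
    · simp [h, h', h.not_gt, h'.not_gt]
    · exact absurd (σ.injective h') h.ne
    · simp [h, h', h.not_gt, h'.not_gt]
  · subst h; simp
  · rcases lt_trichotomy (σ l) (σ j) with h' | h' | h'
    · simp [h, h', h.not_gt, h'.not_gt, two]
    · exact absurd (σ.injective h') h.ne'
    · simp [h, h', h.not_gt, h'.not_gt]

/-! ### Composites of graded `𝕊`-modules and of morphisms -/

/-- Transporting an index along a bijection. -/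
abbrev CompIdx.map {X X' : Type} {n m : ℤ} (e : X ≃ X') (h : n = m) (i : CompIdx X n) :
    CompIdx X' m :=
  ⟨i.r, fun x => i.f (e.symm x), i.p, i.q, i.deg.trans h⟩

/-- Changing the degree of the first factor. -/
abbrev CompIdx.shiftLeft {X : Type} {n m s : ℤ} (h : m = n + s) (i : CompIdx X n) : CompIdx X m :=
  ⟨i.r, i.f, i.p + s, i.q, by have := i.deg; omega⟩

/-- Changing the degrees of the first factor and of the factor of the block `j`. -/
abbrev CompIdx.shiftAt {X : Type} {n m s t u : ℤ} (hu : u = s + t) (h : m = n + u)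
    (i : CompIdx X n) (j : Fin i.r) : CompIdx X m :=
  ⟨i.r, i.f, i.p + s, fun l => i.q l + if l = j then t else 0, by
    have := i.deg
    rw [Finset.sum_add_distrib]
    simp
    omega⟩

/-- The block at `j` and its image under a bijection `e`. -/
def blockMap {X X' Y : Type} (e : X ≃ X') (f : X → Y) (j : Y) :
    {x // f x = j} ≃ {x // f (e.symm x) = j} :=
  e.subtypeEquiv fun x => by rw [e.symm_apply_apply]

section compMaps

variable {A B A' B' A'' B'' : GSMod k} {X X' : Type} [Finite X] [Finite X'] {n m : ℤ}

/-- The map `a ⊗ b₁ ⊗ ⋯ ⊗ b_r ↦ φ a ⊗ ψ₁ b₁ ⊗ ⋯ ⊗ ψ_r b_r` on a summand. -/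
def compTensor (i : CompIdx X n) (f' : X' → Fin i.r) (p' : ℤ) (q' : Fin i.r → ℤ)
    (h' : p' + ∑ j, q' j = m) (φ : A.obj (Fin i.r) i.p →ₗ[k] A'.obj (Fin i.r) p')
    (ψ : ∀ j, B.obj {x // i.f x = j} (i.q j) →ₗ[k] B'.obj {x // f' x = j} (q' j)) :
    CompSummand A B i →ₗ[k] CompObj A' B' X' m :=
  (compIncl (⟨i.r, f', p', q', h'⟩ : CompIdx X' m)).comp
    (TensorProduct.map φ (PiTensorProduct.map ψ))

theorem compTensor_pure (i : CompIdx X n) (f' : X' → Fin i.r) (p' : ℤ) (q' : Fin i.r → ℤ)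
    (h' : p' + ∑ j, q' j = m) (φ : A.obj (Fin i.r) i.p →ₗ[k] A'.obj (Fin i.r) p')
    (ψ : ∀ j, B.obj {x // i.f x = j} (i.q j) →ₗ[k] B'.obj {x // f' x = j} (q' j))
    (a : A.obj (Fin i.r) i.p) (b : ∀ j, B.obj {x // i.f x = j} (i.q j)) :
    compTensor (A' := A') (B' := B') i f' p' q' h' φ ψ (pureTensor i a b)
      = compMk (⟨i.r, f', p', q', h'⟩ : CompIdx X' m) (φ a) (fun j => ψ j (b j)) := by
  simp [compTensor, compMk, pureTensor]

/-- The functoriality of `(A ∘ B)(X)` in the finite set `X`. -/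
def compObjMap (A B : GSMod k) (e : X ≃ X') (h : n = m) : CompObj A B X n →ₗ[k] CompObj A B X' m :=
  compLift (fun i => compTensor i (i.map e h).f i.p i.q (i.map e h).deg LinearMap.id
      fun j => B.map (blockMap e i.f j) rfl) <| by
    intro i i' σ hi a b a' b' hab
    beta_reduce
    rw [compTensor_pure, compTensor_pure]
    refine compMk_perm (i := i.map e h) (i' := i'.map e h) ⟨fun x => hi.f _, hi.p, hi.q⟩
      ⟨hab.1, fun j => ?_⟩
    change B.map _ _ (b' (σ j)) = B.map _ _ (B.map _ _ (b j))
    rw [hab.2, B.map_map, B.map_map]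
    rfl

theorem compObjMap_mk (e : X ≃ X') (h : n = m) (i : CompIdx X n) (a : A.obj (Fin i.r) i.p)
    (b : ∀ j, B.obj {x // i.f x = j} (i.q j)) :
    compObjMap A B e h (compMk i a b) =
      compMk (A := A) (B := B) (i.map e h) a (fun j => B.map (blockMap e i.f j) rfl (b j)) := by
  rw [compObjMap, compLift_mk, compTensor_pure]
  rfl

/-- The composition product of graded `𝕊`-modules. -/
@[reducible] def GSMod.comp (A B : GSMod k) : GSMod k where
  obj X _ n := CompObj A B X n
  map e _ _ h := compObjMap A B e h
  map_refl := by
    intro X _ n x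
    refine comp_ext_apply (compObjMap A B _ _) LinearMap.id (fun i a b => ?_) x
    rw [compObjMap_mk]
    exact compMk_congr (fun _ => rfl) rfl (fun _ => rfl) (A.map_refl _).symm (fun j => rfl)
  map_map := by
    intro X Y Z _ _ _ e e' n m l h h' x
    refine comp_ext_apply ((compObjMap A B e' h').comp (compObjMap A B e h))
      (compObjMap A B (e.trans e') _) (fun i a b => ?_) x
    rw [LinearMap.comp_apply, compObjMap_mk, compObjMap_mk, compObjMap_mk]
    refine compMk_congr (fun _ => rfl) rfl (fun _ => rfl) (A.map_refl _).symm fun j => ?_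
    rw [B.map_map]
    exact (B.map_map (blockMap (e.trans e') i.f j) (blockCongr _ j) rfl rfl (b j)).symm

/-- The components of `compMap`. -/
def compMapObj {s : ℤ} (φ : GHom s A A') (η : GHom 0 B B') (h : m = n + s) :
    CompObj A B X n →ₗ[k] CompObj A' B' X m :=
  compLift (fun i => compTensor i i.f (i.p + s) i.q (i.shiftLeft h).deg (φ.app rfl)
      fun j => η.app (by simp)) <| by
    intro i i' σ hi a b a' b' hab
    beta_reduce
    rw [compTensor_pure, compTensor_pure]
    refine compMk_perm (i := i.shiftLeft h) (i' := i'.shiftLeft h) ⟨hi.f, by simp [hi.p], hi.q⟩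
      ⟨?_, fun j => ?_⟩
    · rw [hab.1]
      exact (φ.naturality _ _ _ _ _ _).symm
    · change η.app _ (b' (σ j)) = B'.map _ _ (η.app _ (b j))
      rw [hab.2]
      exact (η.naturality _ _ _ _ _ _).symm

theorem compMapObj_mk {s : ℤ} (φ : GHom s A A') (η : GHom 0 B B') (h : m = n + s)
    (i : CompIdx X n) (a : A.obj (Fin i.r) i.p) (b : ∀ j, B.obj {x // i.f x = j} (i.q j)) :
    compMapObj φ η h (compMk i a b) = compMk (A := A') (B := B') (i.shiftLeft h) (φ.app rfl a)
      (fun j => η.app (by simp) (b j)) := by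
  rw [compMapObj, compLift_mk, compTensor_pure]

/-- The composite `φ ∘ η : A ∘ B → A' ∘ B'`, for `η` of degree `0`:
`(φ ∘ η)(a ⊗ b₁ ⊗ ⋯ ⊗ b_r) = φ a ⊗ η b₁ ⊗ ⋯ ⊗ η b_r`. -/
def compMap {s : ℤ} (φ : GHom s A A') (η : GHom 0 B B') : GHom s (A.comp B) (A'.comp B') where
  app h := compMapObj φ η h
  naturality {X Y} _ _ e n m n' m' h h' hn hm x := by
    refine comp_ext_apply ((compObjMap A' B' e hm).comp (compMapObj φ η h))
      ((compMapObj φ η h').comp (compObjMap A B e hn)) (fun i a b => ?_) x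
    rw [LinearMap.comp_apply, LinearMap.comp_apply, compMapObj_mk, compObjMap_mk, compObjMap_mk,
      compMapObj_mk]
    refine compMk_congr (fun _ => rfl) rfl (fun _ => rfl) (A'.map_refl _).symm fun j => ?_
    rw [← η.naturality (blockMap e i.f j) (by simp) (by simp) rfl rfl, B'.map_map]
    rfl

/-- The map applied to the factor `l` in the `j`-th summand of `φ ∘ (η; θ)`: it is `θ` for `l = j`
and `η` otherwise. -/
def infFactor {t : ℤ} (η : GHom 0 B B') (θ : GHom t B B') {r : ℕ} (f : X → Fin r)
    (q : Fin r → ℤ) (j l : Fin r) : B.obj {x // f x = l} (q l) →ₗ[k]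
      B'.obj {x // f x = l} (q l + if l = j then t else 0) :=
  if h : l = j then θ.app (by simp [h]) else η.app (by simp [h])

theorem infFactor_naturality {t : ℤ} (η : GHom 0 B B') (θ : GHom t B B') {r r' : ℕ}
    (σ : Fin r ≃ Fin r') (f : X → Fin r) (f' : X' → Fin r') (q : Fin r → ℤ) (q' : Fin r' → ℤ)
    (j l : Fin r) (e : {x // f x = l} ≃ {x // f' x = σ l}) (hq : q l = q' (σ l))
    (hq' : q l + (if l = j then t else 0) = q' (σ l) + if σ l = σ j then t else 0)
    (b : B.obj {x // f x = l} (q l)) :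
    B'.map e hq' (infFactor η θ f q j l b) = infFactor η θ f' q' (σ j) (σ l) (B.map e hq b) := by
  unfold infFactor
  by_cases h : l = j
  · rw [dif_pos h, dif_pos (congrArg σ h)]
    exact θ.naturality _ _ _ _ _ _
  · rw [dif_neg h, dif_neg (fun h' => h (σ.injective h'))]
    exact η.naturality _ _ _ _ _ _

/-- The components of `infComp`. -/
def infCompObj {s t u : ℤ} (φ : GHom s A A') (η : GHom 0 B B') (θ : GHom t B B') (hu : u = s + t)
    (h : m = n + u) : CompObj A B X n →ₗ[k] CompObj A' B' X m :=
  compLift (fun i => ∑ j, (-1 : k) ^ (t * (i.p + ∑ l with l < j, i.q l)) •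
      compTensor i i.f (i.p + s) (i.shiftAt hu h j).q (i.shiftAt hu h j).deg
        (φ.app rfl) (infFactor η θ i.f i.q j)) <| by
    intro i i' σ hi a b a' b' hab
    beta_reduce
    rw [LinearMap.sum_apply, LinearMap.sum_apply, ← Equiv.sum_comp σ, Finset.smul_sum]
    refine Finset.sum_congr rfl fun j _ => ?_
    rw [LinearMap.smul_apply, LinearMap.smul_apply, compTensor_pure, compTensor_pure]
    rw [compMk_perm (A := A') (B := B') (i := i.shiftAt hu h j) (i' := i'.shiftAt hu h (σ j))
      (σ := σ) ⟨hi.f, by simp [hi.p], fun l => by simp [hi.q]⟩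
      (a := φ.app rfl a) (b := fun l => infFactor η θ i.f i.q j l (b l))
      ⟨by rw [hab.1]; exact (φ.naturality _ _ _ _ _ _).symm, fun l => by
        change infFactor η θ i'.f i'.q (σ j) (σ l) (b' (σ l)) = _
        rw [hab.2]; exact (infFactor_naturality η θ σ i.f i'.f i.q i'.q j l _ _ _ _).symm⟩,
      smul_smul, smul_smul, ← zpow_add₀ (by simp), ← zpow_add₀ (by simp)]
    congr 1
    apply negOne_zpow_congr
    have := koszulExp_update σ i.q i'.q hi.q j t
    push_cast at this ⊢
    rw [hi.p]
    linear_combination this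

theorem infCompObj_mk {s t u : ℤ} (φ : GHom s A A') (η : GHom 0 B B') (θ : GHom t B B')
    (hu : u = s + t) (h : m = n + u) (i : CompIdx X n)
    (a : A.obj (Fin i.r) i.p) (b : ∀ j, B.obj {x // i.f x = j} (i.q j)) :
    infCompObj φ η θ hu h (compMk i a b) =
      ∑ j, (-1 : k) ^ (t * (i.p + ∑ l with l < j, i.q l)) • compMk (A := A') (B := B')
        (i.shiftAt hu h j) (φ.app rfl a) (fun l => infFactor η θ i.f i.q j l (b l)) := by
  rw [infCompObj, compLift_mk, LinearMap.sum_apply]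
  refine Finset.sum_congr rfl fun j _ => ?_
  rw [LinearMap.smul_apply, compTensor_pure]

/-- The infinitesimal composite of morphisms `φ ∘ (η; θ) : A ∘ B → A' ∘ B'`, for `η` of degree `0`:
one applies `φ` to the factor in `A`, `θ` to one of the factors in `B` and `η` to all the others,
and takes the sum over all choices:
`a ⊗ b₁ ⊗ ⋯ ⊗ b_r ↦ ∑ⱼ ± φ a ⊗ η b₁ ⊗ ⋯ ⊗ θ bⱼ ⊗ ⋯ ⊗ η b_r`, where `±` is the Koszul sign from
moving `θ` past `a, b₁, …, bⱼ₋₁`. In particular `φ ∘ (id; θ)` is the infinitesimal composite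
usually denoted `φ ∘' θ`. -/
def infComp {s t u : ℤ} (φ : GHom s A A') (η : GHom 0 B B') (θ : GHom t B B') (hu : u = s + t) :
    GHom u (A.comp B) (A'.comp B') where
  app h := infCompObj φ η θ hu h
  naturality {X Y} _ _ e n m n' m' h h' hn hm x := by
    refine comp_ext_apply ((compObjMap A' B' e hm).comp (infCompObj φ η θ hu h))
      ((infCompObj φ η θ hu h').comp (compObjMap A B e hn)) (fun i a b => ?_) x
    rw [LinearMap.comp_apply, LinearMap.comp_apply, infCompObj_mk, compObjMap_mk, infCompObj_mk,
      map_sum]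
    refine Finset.sum_congr rfl fun j _ => ?_
    rw [map_smul, compObjMap_mk]
    congr 1
    refine compMk_congr (fun _ => rfl) rfl (fun _ => rfl) (A'.map_refl _).symm fun l => ?_
    refine (infFactor_naturality η θ (Equiv.refl _) i.f (fun x => i.f (e.symm x)) i.q i.q j l
      (blockMap e i.f l) rfl rfl (b l)).trans ?_
    exact (B'.map_refl _).symm

end compMaps

/-! ### The associator -/

/-- The exponent of the Koszul sign of the rearrangement
`(b₁, …, b_r, c₁, …, c_s) ↦ (b₁, (c_j)_{f j = 1}, …, b_r, (c_j)_{f j = r})`. -/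
def assocExp {r s : ℕ} (f : Fin s → Fin r) (p : Fin r → ℤ) (q : Fin s → ℤ) : ℤ :=
  (∑ i, ∑ j, if f j < i then p i * q j else 0)
    + ∑ j, ∑ l, if j < l ∧ f l < f j then q j * q l else 0

theorem sum_symm {ι : Type} [Fintype ι] [LinearOrder ι] (F : ι → ι → ZMod 2)
    (h : ∀ i, F i i = 0) :
    ∑ i, ∑ j, F i j = ∑ i, ∑ j, if i < j then F i j + F j i else 0 := by
  have h1 : ∀ i j, F i j = (if i < j then F i j else 0) + if j < i then F i j else 0 := by
    intro i j
    rcases lt_trichotomy i j with h' | h' | h'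
    · simp [h', h'.not_gt]
    · subst h'; simp [h]
    · simp [h', h'.not_gt]
  calc ∑ i, ∑ j, F i j = ∑ i, ∑ j, ((if i < j then F i j else 0) + if j < i then F i j else 0) :=
        Finset.sum_congr rfl fun i _ => Finset.sum_congr rfl fun j _ => h1 i j
    _ = (∑ i, ∑ j, if i < j then F i j else 0) + ∑ i, ∑ j, if j < i then F i j else 0 := by
        simp only [Finset.sum_add_distrib]
    _ = (∑ i, ∑ j, if i < j then F i j else 0) + ∑ i, ∑ j, if i < j then F j i else 0 := by
        rw [Finset.sum_comm (f := fun i j => if j < i then F i j else 0)]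
    _ = _ := by
        rw [← Finset.sum_add_distrib]
        refine Finset.sum_congr rfl fun i _ => ?_
        rw [← Finset.sum_add_distrib]
        refine Finset.sum_congr rfl fun j _ => ?_
        split_ifs <;> simp

/-- The restriction of `σ` to corresponding blocks. -/
def fiberEquiv {S S' R R' : Type} {f : S → R} {f' : S' → R'} (σ : S ≃ S') (τ : R ≃ R')
    (h : ∀ j, f' (σ j) = τ (f j)) (i : R) : {j // f j = i} ≃ {j // f' j = τ i} :=
  σ.subtypeEquiv fun j => by rw [h]; exact τ.apply_eq_iff_eq.symm

theorem assocExp_perm {r r' s s' : ℕ} (f : Fin s → Fin r) (f' : Fin s' → Fin r')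
    (σ : Fin s ≃ Fin s') (τ : Fin r ≃ Fin r') (h : ∀ j, f' (σ j) = τ (f j))
    (p : Fin r → ℤ) (p' : Fin r' → ℤ) (hp : ∀ i, p i = p' (τ i))
    (q : Fin s → ℤ) (q' : Fin s' → ℤ) (hq : ∀ j, q j = q' (σ j)) :
    ((assocExp f' p' q' + ((∑ i, koszulExp (fiberEquiv σ τ h i) fun j => q j.1)
      + koszulExp τ fun i => p i + ∑ j : {j // f j = i}, q j.1) : ℤ) : ZMod 2)
      = ((assocExp f p q + (koszulExp σ q + koszulExp τ p) : ℤ) : ZMod 2) := by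
  have e1 : assocExp f' p' q' = (∑ i, ∑ j, if τ (f j) < τ i then p i * q j else 0)
      + ∑ j, ∑ l, if σ j < σ l ∧ τ (f l) < τ (f j) then q j * q l else 0 := by
    unfold assocExp
    rw [← Equiv.sum_comp τ, ← Equiv.sum_comp σ]
    congr 1
    · refine Finset.sum_congr rfl fun i _ => ?_
      rw [← Equiv.sum_comp σ]
      simp [hp, hq, h]
    · refine Finset.sum_congr rfl fun i _ => ?_
      rw [← Equiv.sum_comp σ]
      simp [hq, h]
  have e2 : (∑ i, koszulExp (fiberEquiv σ τ h i) fun j => q j.1)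
      = ∑ j, ∑ l, if f j = f l ∧ j < l ∧ σ l < σ j then q j * q l else 0 := by
    unfold koszulExp
    rw [← (Equiv.sigmaFiberEquiv f).sum_comp, Fintype.sum_sigma]
    refine Finset.sum_congr rfl fun i _ => Finset.sum_congr rfl fun j _ => ?_
    rw [← (Equiv.sigmaFiberEquiv f).sum_comp, Fintype.sum_sigma]
    rw [Finset.sum_eq_single i]
    · refine Finset.sum_congr rfl fun l _ => ?_
      have : f j.1 = f l.1 := j.2.trans l.2.symm
      simp only [Equiv.sigmaFiberEquiv_apply, this, true_and]
      rfl
    · intro i' _ hi'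
      refine Finset.sum_eq_zero fun l _ => if_neg fun hl => hi' ?_
      exact l.2.symm.trans (hl.1.symm.trans j.2)
    · simp
  have e4 : (koszulExp τ fun i => p i + ∑ j : {j // f j = i}, q j.1)
      = koszulExp τ p
        + (∑ i, ∑ j, if i < f j ∧ τ (f j) < τ i then p i * q j else 0)
        + (∑ i, ∑ j, if f j < i ∧ τ i < τ (f j) then p i * q j else 0)
        + ∑ j, ∑ l, if f j < f l ∧ τ (f l) < τ (f j) then q j * q l else 0 := by
    have sub : ∀ i, ∑ j : {j // f j = i}, q j.1 = ∑ j, if f j = i then q j else 0 := by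
      intro i
      rw [← Finset.sum_filter, Finset.sum_subtype (p := fun j => f j = i) _ (by simp)]
    have expand : ∀ i l, (if i < l ∧ τ l < τ i then (p i + ∑ j : {j // f j = i}, q j.1)
          * (p l + ∑ j : {j // f j = l}, q j.1) else 0)
        = (if i < l ∧ τ l < τ i then p i * p l else 0)
          + (∑ j, if f j = l then (if i < f j ∧ τ (f j) < τ i then p i * q j else 0) else 0)
          + (∑ j, if f j = i then (if f j < l ∧ τ l < τ (f j) then p l * q j else 0) else 0)
          + ∑ j, ∑ m, if f j = i then (if f m = l then
              (if f j < f m ∧ τ (f m) < τ (f j) then q j * q m else 0) else 0) else 0 := by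
      intro i l
      rw [sub, sub]
      by_cases hil : i < l ∧ τ l < τ i
      · rw [if_pos hil, if_pos hil, add_mul, mul_add, mul_add, Finset.mul_sum, Finset.sum_mul,
          Finset.sum_mul_sum, ← add_assoc]
        congr 1
        · congr 1
          · congr 1
            refine Finset.sum_congr rfl fun j _ => ?_
            by_cases hj : f j = l
            · subst hj; simp [hil]
            · simp [hj]
          · refine Finset.sum_congr rfl fun j _ => ?_
            by_cases hj : f j = i
            · subst hj; simp [hil, mul_comm]
            · simp [hj]
        · refine Finset.sum_congr rfl fun j _ => Finset.sum_congr rfl fun m _ => ?_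
          by_cases hj : f j = i
          · by_cases hm : f m = l
            · subst hj; subst hm; simp [hil]
            · simp [hm]
          · simp [hj]
      · rw [if_neg hil, if_neg hil, Finset.sum_eq_zero, Finset.sum_eq_zero, Finset.sum_eq_zero]
        · simp
        · intro j _
          refine Finset.sum_eq_zero fun m _ => ?_
          by_cases hj : f j = i
          · by_cases hm : f m = l
            · subst hj; subst hm; simp [hil]
            · simp [hm]
          · simp [hj]
        · intro j _
          by_cases hj : f j = i
          · subst hj; simp [hil]
          · simp [hj]
        · intro j _
          by_cases hj : f j = l
          · subst hj; simp [hil]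
          · simp [hj]
    unfold koszulExp
    simp only [expand, Finset.sum_add_distrib]
    congr 1
    · congr 1
      · congr 1
        refine Finset.sum_congr rfl fun i _ => ?_
        rw [Finset.sum_comm]
        simp
      · rw [Finset.sum_comm]
        refine Finset.sum_congr rfl fun i _ => ?_
        rw [Finset.sum_comm]
        simp
    · have : ∀ j m : Fin s, ∑ i, ∑ l, (if f j = i then (if f m = l then
              (if f j < f m ∧ τ (f m) < τ (f j) then q j * q m else 0) else 0) else 0)
          = if f j < f m ∧ τ (f m) < τ (f j) then q j * q m else 0 := by
        intro j m
        rw [Finset.sum_comm]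
        simp
      refine Eq.trans ?_ (Finset.sum_congr rfl fun j _ => Finset.sum_congr rfl fun m _ => this j m)
      rw [Finset.sum_congr rfl fun i _ => Finset.sum_comm]
      rw [Finset.sum_comm]
      refine Finset.sum_congr rfl fun j _ => ?_
      rw [Finset.sum_congr rfl fun i _ => Finset.sum_comm]
      rw [Finset.sum_comm]
  have two : ∀ x : ZMod 2, x + x = 0 := by decide
  -- the terms pairing some `b` with some `c`
  have bc : (((∑ i, ∑ j, if τ (f j) < τ i then p i * q j else 0)
      + (∑ i, ∑ j, if i < f j ∧ τ (f j) < τ i then p i * q j else 0)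
      + (∑ i, ∑ j, if f j < i ∧ τ i < τ (f j) then p i * q j else 0) : ℤ) : ZMod 2)
      = ((∑ i, ∑ j, if f j < i then p i * q j else 0 : ℤ) : ZMod 2) := by
    push_cast
    simp only [← Finset.sum_add_distrib]
    refine Finset.sum_congr rfl fun i _ => Finset.sum_congr rfl fun j _ => ?_
    rcases lt_trichotomy (f j) i with h1 | h1 | h1
    · rcases lt_trichotomy (τ (f j)) (τ i) with h2 | h2 | h2
      · simp [h1, h2, h1.not_gt, h2.not_gt]
      · exact absurd (τ.injective h2) h1.ne
      · simp [h1, h2, h1.not_gt, h2.not_gt]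
    · simp [h1]
    · rcases lt_trichotomy (τ (f j)) (τ i) with h2 | h2 | h2
      · simp [h1, h2, h1.not_gt, h2.not_gt, two]
      · exact absurd (τ.injective h2) h1.ne'
      · simp [h1, h2, h1.not_gt, h2.not_gt]
  -- the terms pairing two of the `c`
  have cc : (((∑ j, ∑ l, if σ j < σ l ∧ τ (f l) < τ (f j) then q j * q l else 0)
      + (∑ j, ∑ l, if f j = f l ∧ j < l ∧ σ l < σ j then q j * q l else 0)
      + (∑ j, ∑ l, if f j < f l ∧ τ (f l) < τ (f j) then q j * q l else 0) : ℤ) : ZMod 2)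
      = (((∑ j, ∑ l, if j < l ∧ f l < f j then q j * q l else 0)
        + koszulExp σ q : ℤ) : ZMod 2) := by
    unfold koszulExp
    push_cast
    simp only [← Finset.sum_add_distrib]
    rw [sum_symm _ (by simp), sum_symm (fun j l => (if j < l ∧ f l < f j then (q j : ZMod 2) * q l
      else 0) + if j < l ∧ σ l < σ j then (q j : ZMod 2) * q l else 0) (by simp)]
    refine Finset.sum_congr rfl fun j _ => Finset.sum_congr rfl fun l _ => ?_
    by_cases hjl : j < l
    · have hs : σ j < σ l ∨ σ l < σ j := lt_or_gt_of_ne fun h => hjl.ne (σ.injective h)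
      rw [if_pos hjl, if_pos hjl]
      generalize (q j : ZMod 2) = x
      generalize (q l : ZMod 2) = y
      rw [mul_comm y x]
      rcases lt_trichotomy (f j) (f l) with h1 | h1 | h1
      · have ht : τ (f j) < τ (f l) ∨ τ (f l) < τ (f j) :=
          lt_or_gt_of_ne fun h => h1.ne (τ.injective h)
        rcases hs with hs | hs <;> rcases ht with ht | ht <;>
          simp [hjl, hjl.not_gt, h1, h1.not_gt, h1.ne, h1.ne', hs, hs.not_gt, ht, ht.not_gt, two]
      · rcases hs with hs | hs <;>
          simp [hjl, hjl.not_gt, h1, hs, hs.not_gt]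
      · have ht : τ (f j) < τ (f l) ∨ τ (f l) < τ (f j) :=
          lt_or_gt_of_ne fun h => h1.ne' (τ.injective h)
        rcases hs with hs | hs <;> rcases ht with ht | ht <;>
          simp [hjl, hjl.not_gt, h1, h1.not_gt, h1.ne, h1.ne', hs, hs.not_gt, ht, ht.not_gt, two]
    · simp [hjl]
  rw [e1, e2, e4]
  unfold assocExp
  push_cast at bc cc ⊢
  linear_combination bc + cc

section assoc

variable {A B C : GSMod k} {X X' : Type} [Finite X] [Finite X'] {n m : ℤ}

/-- The increasing enumeration of a finite linearly ordered set. -/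
def ordFin (Y : Type) [Fintype Y] [LinearOrder Y] : Y ≃o Fin (Fintype.card Y) :=
  (Fintype.orderIsoFinOfCardEq Y rfl).symm

theorem koszulExp_conj {Y Y' : Type} [Fintype Y] [LinearOrder Y] [Fintype Y'] [LinearOrder Y']
    (φ : Y ≃ Y') (q : Y → ℤ) :
    koszulExp ((ordFin Y).symm.toEquiv.trans (φ.trans (ordFin Y').toEquiv))
      (fun l => q ((ordFin Y).symm l)) = koszulExp φ q := by
  unfold koszulExp
  rw [← Equiv.sum_comp (ordFin Y).toEquiv]
  refine Finset.sum_congr rfl fun i _ => ?_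
  rw [← Equiv.sum_comp (ordFin Y).toEquiv]
  simp

theorem compObjMap_compObjMap {X'' : Type} [Finite X''] {l : ℤ} (e : X ≃ X') (e' : X' ≃ X'')
    (e'' : X ≃ X'') (he : ∀ x, e' (e x) = e'' x) (h : n = m) (h' : m = l)
    (z : CompObj A B X n) :
    compObjMap A B e' h' (compObjMap A B e h z) = compObjMap A B e'' (h.trans h') z := by
  obtain rfl : e.trans e' = e'' := Equiv.ext he
  exact (A.comp B).map_map e e' h h' z

theorem compMk_perm_smul {i i' : CompIdx X n} {σ : Fin i.r ≃ Fin i'.r} (h : IsRenumbering i i' σ)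
    {a : A.obj (Fin i.r) i.p} {b : ∀ j, B.obj {x // i.f x = j} (i.q j)}
    {a' : A.obj (Fin i'.r) i'.p} {b' : ∀ j, B.obj {x // i'.f x = j} (i'.q j)}
    (c : Fin i.r → k) (ha : a' = A.map σ h.p a)
    (hb : ∀ j, b' (σ j) = c j • B.map (blockPerm σ h.f j) (h.q j) (b j)) :
    compMk i' a' b' = ((∏ j, c j) * (-1 : k) ^ koszulExp σ i.q) • compMk i a b := by
  have h1 := compMk_perm (i := i) (i' := i') (σ := σ) h (a := a) (b := fun j => c j • b j)
    (a' := a') (b' := b') ⟨ha, fun j => by rw [hb, map_smul]⟩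
  have h2 : compMk i a (fun j => c j • b j) = (∏ j, c j) • compMk i a b := by
    unfold compMk pureTensor
    rw [MultilinearMap.map_smul_univ, TensorProduct.tmul_smul, map_smul]
  rw [h1, h2, smul_smul, mul_comm]

/-- The index of the composite of the `b` of the block `i` with the `c_j`, `f j = i`. -/
abbrev innerIdx {r s : ℕ} (g : X → Fin s) (f : Fin s → Fin r) (i : Fin r) (p : ℤ)
    (q : Fin s → ℤ) : CompIdx {x // f (g x) = i} (p + ∑ j : {j // f j = i}, q j.1) where
  r := Fintype.card {j // f j = i}
  f x := ordFin _ ⟨g x.1, x.2⟩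
  p := p
  q l := q ((ordFin {j // f j = i}).symm l).1
  deg := by
    congr 1
    exact Equiv.sum_comp (ordFin {j // f j = i}).symm.toEquiv fun j => q j.1

/-- The blocks of `innerIdx` are blocks of `g`. -/
def innerBlock {r s : ℕ} (g : X → Fin s) (f : Fin s → Fin r) (i : Fin r)
    (l : Fin (Fintype.card {j // f j = i})) :
    {x // g x = ((ordFin {j // f j = i}).symm l).1} ≃
      {x : {x // f (g x) = i} // ordFin {j // f j = i} ⟨g x.1, x.2⟩ = l} where
  toFun x := ⟨⟨x.1, by rw [x.2]; exact ((ordFin {j // f j = i}).symm l).2⟩, by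
    rw [← OrderIso.eq_symm_apply]; exact Subtype.ext x.2⟩
  invFun x := ⟨x.1.1, by
    have := x.2
    rw [← OrderIso.eq_symm_apply] at this
    exact congrArg Subtype.val this⟩
  left_inv _ := rfl
  right_inv _ := rfl

/-- The generator `b ⊗ (c_j)_{f j = i}` of `(B ∘ C)({x | f (g x) = i})`. -/
def innerMk {r s : ℕ} (g : X → Fin s) (f : Fin s → Fin r) (i : Fin r) {p : ℤ}
    {q : Fin s → ℤ} (b : B.obj {j // f j = i} p)
    (c : ∀ y : {j // f j = i}, C.obj {x // g x = y.1} (q y.1)) :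
    CompObj B C {x // f (g x) = i} (p + ∑ j : {j // f j = i}, q j.1) :=
  compMk (innerIdx g f i p q) (B.map (ordFin {j // f j = i}).toEquiv rfl b)
    fun l => C.map (innerBlock g f i l) rfl (c ((ordFin {j // f j = i}).symm l))

/-- `innerMk` as a bilinear map. -/
def innerMap (B C : GSMod k) {r s : ℕ} (g : X → Fin s) (f : Fin s → Fin r) (i : Fin r) (p : ℤ)
    (q : Fin s → ℤ) : B.obj {j // f j = i} p →ₗ[k]
      (⨂[k] y : {j // f j = i}, C.obj {x // g x = y.1} (q y.1)) →ₗ[k]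
        CompObj B C {x // f (g x) = i} (p + ∑ j : {j // f j = i}, q j.1) :=
  (TensorProduct.curry (compIncl (A := B) (B := C) (innerIdx g f i p q))).compl₁₂
    (B.map (ordFin {j // f j = i}).toEquiv rfl)
    ((PiTensorProduct.map fun l => C.map (innerBlock g f i l) rfl) ∘ₗ
      (PiTensorProduct.reindex k (fun y : {j // f j = i} => C.obj {x // g x = y.1} (q y.1))
        (ordFin {j // f j = i}).toEquiv).toLinearMap)

theorem innerMap_tprod {r s : ℕ} (g : X → Fin s) (f : Fin s → Fin r) (i : Fin r) (p : ℤ)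
    (q : Fin s → ℤ) (b : B.obj {j // f j = i} p)
    (c : ∀ y : {j // f j = i}, C.obj {x // g x = y.1} (q y.1)) :
    innerMap B C g f i p q b (PiTensorProduct.tprod k c) = innerMk g f i b c := by
  refine congrArg (fun z => compIncl (A := B) (B := C) (innerIdx g f i p q)
    (B.map (ordFin {j // f j = i}).toEquiv rfl b ⊗ₜ z)) ?_
  refine (congrArg (PiTensorProduct.map fun l => C.map (innerBlock g f i l) rfl)
    (PiTensorProduct.reindex_tprod (R := k)
    (s := fun y : {j // f j = i} => C.obj {x // g x = y.1} (q y.1))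
    (ordFin {j // f j = i}).toEquiv c)).trans ?_
  exact PiTensorProduct.map_tprod _ _

theorem innerMk_perm {r r' s s' : ℕ} {g : X → Fin s} {g' : X' → Fin s'} {f : Fin s → Fin r}
    {f' : Fin s' → Fin r'} (ε : X ≃ X') (σ : Fin s ≃ Fin s') (τ : Fin r ≃ Fin r')
    (hg : ∀ x, g' (ε x) = σ (g x)) (hf : ∀ j, f' (σ j) = τ (f j))
    (hfg : ∀ x, f' (g' (ε x)) = τ (f (g x))) (i : Fin r) {p p' : ℤ} {q : Fin s → ℤ}
    {q' : Fin s' → ℤ} (hp : p = p') (hq : ∀ j, q j = q' (σ j))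
    (hd : p + ∑ j : {j // f j = i}, q j.1 = p' + ∑ j : {j // f' j = τ i}, q' j.1)
    {b : B.obj {j // f j = i} p} {c : ∀ y : {j // f j = i}, C.obj {x // g x = y.1} (q y.1)}
    {b' : B.obj {j // f' j = τ i} p'}
    {c' : ∀ y : {j // f' j = τ i}, C.obj {x // g' x = y.1} (q' y.1)}
    (hb : b' = B.map (fiberEquiv σ τ hf i) hp b)
    (hc : ∀ y, c' (fiberEquiv σ τ hf i y) = C.map (fiberEquiv ε σ hg y.1) (hq y.1) (c y)) :
    innerMk g' f' (τ i) b' c' = (-1 : k) ^ koszulExp (fiberEquiv σ τ hf i) (fun j => q j.1) •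
      compObjMap B C (fiberEquiv ε τ hfg i) hd (innerMk g f i b c) := by
  unfold innerMk
  rw [compObjMap_mk]
  have key := compMk_perm (A := B) (B := C)
    (i := (innerIdx g f i p q).map (fiberEquiv ε τ hfg i) hd)
    (i' := innerIdx g' f' (τ i) p' q')
    (σ := (ordFin {j // f j = i}).symm.toEquiv.trans ((fiberEquiv σ τ hf i).trans
      (ordFin {j // f' j = τ i}).toEquiv))
    ⟨by
      intro x
      obtain ⟨x, rfl⟩ := (fiberEquiv ε τ hfg i).surjective x
      simp only [Equiv.symm_apply_apply, Equiv.trans_apply, RelIso.coe_fn_toEquiv,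
        OrderIso.symm_apply_apply]
      congr 1
      exact Subtype.ext (hg x.1), hp, by
      intro l
      simp only [Equiv.trans_apply, RelIso.coe_fn_toEquiv, OrderIso.symm_apply_apply]
      exact hq _⟩
    (a := B.map (ordFin {j // f j = i}).toEquiv rfl b)
    (b := fun l => C.map (blockMap (fiberEquiv ε τ hfg i) (innerIdx g f i p q).f l) rfl
      (C.map (innerBlock g f i l) rfl (c ((ordFin {j // f j = i}).symm l))))
    (a' := B.map (ordFin {j // f' j = τ i}).toEquiv rfl b')
    (b' := fun l => C.map (innerBlock g' f' (τ i) l) rfl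
      (c' ((ordFin {j // f' j = τ i}).symm l)))
    ⟨by
      subst hb
      rw [B.map_map, B.map_map]
      congr 2
      ext x
      simp, by
      intro l
      obtain ⟨y, rfl⟩ := (ordFin {j // f j = i}).surjective l
      have aux : ∀ (y' : {j // f' j = τ i}) (y₁ : {j // f j = i}) (l') (hy : y' = fiberEquiv σ τ hf i y₁)
          (e : {x // g' x = y'.1} ≃ _) (e' : {x // g x = y₁.1} ≃ {x // (innerIdx g' f' (τ i) p' q').f x = l'}) (h1 h2),
          (∀ x h h', (e ⟨ε x, h⟩) = e' ⟨x, h'⟩) →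
          C.map (m := (innerIdx g' f' (τ i) p' q').q l') e h1 (c' y') = C.map e' h2 (c y₁) := by
        rintro y' y₁ l' rfl e e' h1 h2 he
        rw [hc]
        refine (C.map_map (fiberEquiv ε σ hg y₁.1) e (hq _) h1 (c y₁)).trans ?_
        congr 2
        ext x
        rw [← he x.1 ((hg _).trans (congrArg σ x.2)) x.2]
        rfl
      rw [C.map_map]
      refine (aux _ _ _ ?_ _ _ _ ?_ ?_).trans (C.map_map _ _ _ _ _).symm
      · simp
      · simp [hq]; rfl
      · intro x h h'
        apply Subtype.ext; apply Subtype.ext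
        rfl⟩
  refine key.trans ?_
  congr 2
  exact koszulExp_conj (fiberEquiv σ τ hf i) (fun j => q j.1)

/-- The index of the rearranged generator in `A ∘ (B ∘ C)`. -/
abbrev assocIdx (J : CompIdx X n) (I : CompIdx (Fin J.r) J.p) : CompIdx X n where
  r := I.r
  f x := I.f (J.f x)
  p := I.p
  q i := I.q i + ∑ j : {j // I.f j = i}, J.q j.1
  deg := by
    rw [Finset.sum_add_distrib, ← add_assoc, I.deg,
      ← Fintype.sum_sigma (fun y : Σ i, {j // I.f j = i} => J.q y.2.1)]
    exact (congrArg (J.p + ·) (Equiv.sum_comp (Equiv.sigmaFiberEquiv I.f) J.q)).trans J.deg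

/-- The image of `(a ⊗ b₁ ⊗ ⋯ ⊗ b_r) ⊗ c₁ ⊗ ⋯ ⊗ c_s` under the associator. -/
def assocMk (J : CompIdx X n) (I : CompIdx (Fin J.r) J.p) (a : A.obj (Fin I.r) I.p)
    (b : ∀ i, B.obj {j // I.f j = i} (I.q i)) (c : ∀ j, C.obj {x // J.f x = j} (J.q j)) :
    CompObj A (B.comp C) X n :=
  (-1 : k) ^ assocExp I.f I.q J.q • compMk (A := A) (B := B.comp C) (assocIdx J I) a
    fun i => innerMk J.f I.f i (b i) fun y => c y.1

theorem assocMk_perm {J : CompIdx X n} {I : CompIdx (Fin J.r) J.p} {J' : CompIdx X' m}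
    {I' : CompIdx (Fin J'.r) J'.p} (h : n = m) (ε : X ≃ X') (σ : Fin J.r ≃ Fin J'.r)
    (τ : Fin I.r ≃ Fin I'.r) (hJ : ∀ x, J'.f (ε x) = σ (J.f x)) (hI : ∀ j, I'.f (σ j) = τ (I.f j))
    (hq : ∀ j, J.q j = J'.q (σ j)) (hp : I.p = I'.p) (hIq : ∀ i, I.q i = I'.q (τ i))
    {a : A.obj (Fin I.r) I.p} {b : ∀ i, B.obj {j // I.f j = i} (I.q i)}
    {c : ∀ j, C.obj {x // J.f x = j} (J.q j)}
    {a' : A.obj (Fin I'.r) I'.p} {b' : ∀ i, B.obj {j // I'.f j = i} (I'.q i)}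
    {c' : ∀ j, C.obj {x // J'.f x = j} (J'.q j)}
    (ha : a' = A.map τ hp a) (hb : ∀ i, b' (τ i) = B.map (fiberEquiv σ τ hI i) (hIq i) (b i))
    (hc : ∀ j, c' (σ j) = C.map (fiberEquiv ε σ hJ j) (hq j) (c j)) :
    assocMk J' I' a' b' c' = (-1 : k) ^ (koszulExp σ J.q + koszulExp τ I.q) •
      compObjMap A (B.comp C) ε h (assocMk J I a b c) := by
  unfold assocMk
  have hsum : ∀ i, ∑ j : {j // I.f j = i}, J.q j.1 = ∑ j : {j // I'.f j = τ i}, J'.q j.1 := by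
    intro i
    rw [← Equiv.sum_comp (fiberEquiv σ τ hI i)]
    exact Finset.sum_congr rfl fun j _ => hq j.1
  have hd : ∀ i, I.q i + ∑ j : {j // I.f j = i}, J.q j.1
      = I'.q (τ i) + ∑ j : {j // I'.f j = τ i}, J'.q j.1 := fun i => by rw [hIq, hsum]
  have hJI : ∀ x, I'.f (J'.f (ε x)) = τ (I.f (J.f x)) := fun x => by rw [hJ, hI]
  have hfac : ∀ i, innerMk J'.f I'.f (τ i) (b' (τ i)) (fun y => c' y.1) =
      (-1 : k) ^ (koszulExp (fiberEquiv σ τ hI i) fun j => J.q j.1) •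
        compObjMap B C (fiberEquiv ε τ hJI i) (hd i) (innerMk J.f I.f i (b i) fun y => c y.1) :=
    fun i => innerMk_perm ε σ τ hJ hI hJI i (hIq i) hq (hd i) (hb i) fun y => hc y.1
  have hx : ∀ x, I'.f (J'.f x) = τ (I.f (J.f (ε.symm x))) := fun x => by
    rw [← hJI, ε.apply_symm_apply]
  have key := compMk_perm_smul (A := A) (B := B.comp C) (i := (assocIdx J I).map ε h)
    (i' := assocIdx J' I') (σ := τ)
    ⟨hx, hp, hd⟩
    (a := a) (a' := a')
    (b := fun i => compObjMap B C (blockMap ε (assocIdx J I).f i) rfl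
      (innerMk J.f I.f i (b i) fun y => c y.1))
    (b' := fun i => innerMk J'.f I'.f i (b' i) fun y => c' y.1)
    (fun i => (-1 : k) ^ koszulExp (fiberEquiv σ τ hI i) fun j => J.q j.1) ha (by
      intro i
      refine (hfac i).trans (congrArg (fun z => (-1 : k) ^
        (koszulExp (fiberEquiv σ τ hI i) fun j => J.q j.1) • z) ?_)
      exact (compObjMap_compObjMap (A := B) (B := C) (blockMap ε (assocIdx J I).f i)
        (blockPerm τ hx i) (fiberEquiv ε τ hJI i) (fun _ => rfl) rfl (hd i) _).symm)
  rw [key, map_smul, compObjMap_mk, smul_smul, smul_smul]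
  congr 1
  have hprod : ∏ i, (-1 : k) ^ (koszulExp (fiberEquiv σ τ hI i) fun j => J.q j.1)
      = (-1 : k) ^ ∑ i, koszulExp (fiberEquiv σ τ hI i) fun j => J.q j.1 := by
    induction (Finset.univ : Finset (Fin I.r)) using Finset.cons_induction with
    | empty => simp
    | cons i s hi ih => rw [Finset.prod_cons, Finset.sum_cons, zpow_add₀ (by simp), ih]
  rw [hprod, ← zpow_add₀ (by simp), ← zpow_add₀ (by simp), ← zpow_add₀ (by simp)]
  apply negOne_zpow_congr
  have := assocExp_perm I.f I'.f σ τ hI I.q I'.q hIq J.q J'.q hq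
  rw [add_comm (koszulExp σ J.q + koszulExp τ I.q)]
  exact this

/-- Grouping the factors `c_j` according to the value of `f j`. -/
def regroup {r s : ℕ} (f : Fin s → Fin r) (M : Fin s → Type u) [∀ j, AddCommGroup (M j)]
    [∀ j, Module k (M j)] :
    (⨂[k] j, M j) →ₗ[k] ⨂[k] i, ⨂[k] y : {j // f j = i}, M y.1 :=
  PiTensorProduct.lift ((PiTensorProduct.tprod k).compMultilinearMap
      fun i => PiTensorProduct.tprod k (s := fun y : {j // f j = i} => M y.1)) ∘ₗ
    (PiTensorProduct.reindex k M (Equiv.sigmaFiberEquiv f).symm).toLinearMap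

theorem regroup_tprod {r s : ℕ} (f : Fin s → Fin r) (M : Fin s → Type u)
    [∀ j, AddCommGroup (M j)] [∀ j, Module k (M j)] (c : ∀ j, M j) :
    regroup (k := k) f M (PiTensorProduct.tprod k c) =
      PiTensorProduct.tprod k fun i => PiTensorProduct.tprod k fun y : {j // f j = i} => c y.1 := by
  refine (congrArg (PiTensorProduct.lift ((PiTensorProduct.tprod k).compMultilinearMap
      fun i => PiTensorProduct.tprod k (s := fun y : {j // f j = i} => M y.1)))
    (PiTensorProduct.reindex_tprod (R := k) (s := M) (Equiv.sigmaFiberEquiv f).symm c)).trans ?_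
  exact PiTensorProduct.lift.tprod _

/-- `assocMk`, without its sign, as a linear map. -/
def assocSummand (A B C : GSMod k) (J : CompIdx X n) (I : CompIdx (Fin J.r) J.p) :
    CompSummand A B I →ₗ[k] (⨂[k] j, C.obj {x // J.f x = j} (J.q j)) →ₗ[k]
      CompObj A (B.comp C) X n :=
  TensorProduct.curry (compIncl (A := A) (B := B.comp C) (assocIdx J I) ∘ₗ
    (TensorProduct.lift ((PiTensorProduct.map₂ fun i =>
        innerMap B C J.f I.f i (I.q i) J.q).compl₂ (regroup I.f _))).lTensor _ ∘ₗ
    (TensorProduct.assoc k _ _ _).toLinearMap)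

theorem assocSummand_pure (J : CompIdx X n) (I : CompIdx (Fin J.r) J.p)
    (a : A.obj (Fin I.r) I.p) (b : ∀ i, B.obj {j // I.f j = i} (I.q i))
    (c : ∀ j, C.obj {x // J.f x = j} (J.q j)) :
    (-1 : k) ^ assocExp I.f I.q J.q • assocSummand A B C J I (pureTensor I a b)
      (PiTensorProduct.tprod k c) = assocMk J I a b c := by
  unfold assocMk
  congr 1
  refine congrArg (fun z => compIncl (A := A) (B := B.comp C) (assocIdx J I) (a ⊗ₜ z)) ?_
  refine (congrArg (PiTensorProduct.map₂ (fun i => innerMap B C J.f I.f i (I.q i) J.q)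
    (PiTensorProduct.tprod k b)) (regroup_tprod (k := k) I.f _ c)).trans ?_
  refine (PiTensorProduct.map₂_tprod_tprod _ _ _).trans ?_
  congr 1
  funext i
  exact innerMap_tprod _ _ _ _ _ _ _

/-- The associator on the summands of `(A ∘ B) ∘ C`. -/
def assocInner (A B C : GSMod k) (J : CompIdx X n) :
    CompObj A B (Fin J.r) J.p →ₗ[k] (⨂[k] j, C.obj {x // J.f x = j} (J.q j)) →ₗ[k]
      CompObj A (B.comp C) X n :=
  compLift (fun I => (-1 : k) ^ assocExp I.f I.q J.q • assocSummand A B C J I) <| by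
    intro I I' τ h a b a' b' hab
    beta_reduce
    refine PiTensorProduct.ext (MultilinearMap.ext fun c => ?_)
    refine (assocSummand_pure J I' a' b' c).trans ?_
    refine Eq.trans ?_ (congrArg (fun z => (-1 : k) ^ koszulExp τ I.q • z)
      (assocSummand_pure J I a b c)).symm
    rw [assocMk_perm (h := rfl) (ε := Equiv.refl X) (σ := Equiv.refl _) (τ := τ) (I := I)
      (hJ := fun x => rfl) (hI := h.f) (hq := fun _ => rfl) (hp := h.p) (hIq := h.q)
      (a := a) (b := b) (c := c) hab.1 hab.2 (fun j => (C.map_refl _).symm),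
      koszulExp_eq_zero (Equiv.refl _) J.q (fun _ _ h => h), zero_add]
    congr 1
    exact (A.comp (B.comp C)).map_refl _

theorem assocInner_mk (J : CompIdx X n) (I : CompIdx (Fin J.r) J.p)
    (a : A.obj (Fin I.r) I.p) (b : ∀ i, B.obj {j // I.f j = i} (I.q i))
    (c : ∀ j, C.obj {x // J.f x = j} (J.q j)) :
    assocInner A B C J (compMk I a b) (PiTensorProduct.tprod k c) = assocMk J I a b c := by
  rw [assocInner, compLift_mk]
  exact assocSummand_pure J I a b c

/-- The components of the associator. -/
def assocObj (A B C : GSMod k) (X : Type) [Finite X] (n : ℤ) :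
    CompObj (A.comp B) C X n →ₗ[k] CompObj A (B.comp C) X n :=
  compLift (A := A.comp B) (B := C) (fun J => TensorProduct.lift (assocInner A B C J)) <| by
    intro J J' σ h x c x' c' hab
    beta_reduce
    change assocInner A B C J' x' (PiTensorProduct.tprod k c') =
      (-1 : k) ^ koszulExp σ J.q • assocInner A B C J x (PiTensorProduct.tprod k c)
    rw [hab.1]
    refine comp_ext_apply
      ((assocInner A B C J').flip (PiTensorProduct.tprod k c') ∘ₗ compObjMap A B σ h.p)
      ((-1 : k) ^ koszulExp σ J.q • (assocInner A B C J).flip (PiTensorProduct.tprod k c))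
      (fun I a b => ?_) x
    simp only [LinearMap.comp_apply, LinearMap.flip_apply, LinearMap.smul_apply]
    rw [compObjMap_mk, assocInner_mk, assocInner_mk]
    rw [assocMk_perm (h := rfl) (ε := Equiv.refl X) (σ := σ) (τ := Equiv.refl _) (I := I)
      (I' := I.map σ h.p)
      (hJ := h.f) (hI := fun j => by simp) (hq := h.q) (hp := rfl)
      (hIq := fun _ => rfl) (a := a) (b := b) (c := c) (A.map_refl _).symm (fun i => rfl) hab.2,
      koszulExp_eq_zero (Equiv.refl _) I.q (fun _ _ h => h), add_zero]
    congr 1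
    exact (A.comp (B.comp C)).map_refl _

theorem assocObj_mk (J : CompIdx X n) (I : CompIdx (Fin J.r) J.p)
    (a : A.obj (Fin I.r) I.p) (b : ∀ i, B.obj {j // I.f j = i} (I.q i))
    (c : ∀ j, C.obj {x // J.f x = j} (J.q j)) :
    assocObj A B C X n (compMk (A := A.comp B) (B := C) J (compMk I a b) c) =
      assocMk J I a b c := by
  rw [assocObj, compLift_mk]
  exact assocInner_mk J I a b c

/-- Two linear maps on `(A ∘ B) ∘ C` agree if they agree on generators. -/
theorem comp_ext₂ {W : Type u} [AddCommGroup W] [Module k W]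
    (F G : CompObj (A.comp B) C X n →ₗ[k] W)
    (h : ∀ J I a b c, F (compMk (A := A.comp B) (B := C) J (compMk (A := A) (B := B) I a b) c)
      = G (compMk (A := A.comp B) (B := C) J (compMk (A := A) (B := B) I a b) c)) (x) :
    F x = G x := by
  refine comp_ext_apply F G (fun J y c => ?_) x
  have L : ∀ H : CompObj (A.comp B) C X n →ₗ[k] W, ∀ y,
      H (compMk (A := A.comp B) (B := C) J y c) =
        (TensorProduct.curry (H ∘ₗ compIncl (A := A.comp B) (B := C) J)).flip
          (PiTensorProduct.tprod k c) y := fun H y => rfl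
  rw [L, L]
  refine comp_ext_apply (A := A) (B := B) _ _ (fun I a b => ?_) y
  exact h J I a b c

/-- The associator `(A ∘ B) ∘ C → A ∘ (B ∘ C)`. -/
def assoc (A B C : GSMod k) : GHom 0 ((A.comp B).comp C) (A.comp (B.comp C)) where
  app {X} _ n _ h := compObjMap A (B.comp C) (Equiv.refl X) (by simp [h]) ∘ₗ assocObj A B C X n
  naturality {X Y} _ _ e n m n' m' h h' hn hm x := by
    refine comp_ext₂ (compObjMap A (B.comp C) e hm ∘ₗ
        compObjMap A (B.comp C) (Equiv.refl X) (by omega) ∘ₗ assocObj A B C X n)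
      (compObjMap A (B.comp C) (Equiv.refl Y) (by omega) ∘ₗ
        assocObj A B C Y n' ∘ₗ compObjMap (A.comp B) C e hn) (fun J I a b c => ?_) x
    simp only [LinearMap.comp_apply]
    rw [compObjMap_mk, assocObj_mk, assocObj_mk]
    rw [assocMk_perm (h := hn) (ε := e) (σ := Equiv.refl _) (τ := Equiv.refl _) (I := I)
      (J' := J.map e hn) (I' := I)
      (hJ := fun x => by simp) (hI := fun j => rfl) (hq := fun _ => rfl) (hp := rfl)
      (hIq := fun _ => rfl) (a := a) (b := b) (c := c) (A.map_refl _).symm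
      (fun i => (B.map_refl _).symm) (fun j => rfl),
      koszulExp_eq_zero (Equiv.refl _) I.q (fun _ _ h => h),
      koszulExp_eq_zero (Equiv.refl _) J.q (fun _ _ h => h), add_zero, zpow_zero, one_smul,
      compObjMap_compObjMap _ _ e (fun _ => rfl), compObjMap_compObjMap _ _ e (fun _ => rfl)]

end assoc

/-! ### Calculus of morphisms -/

namespace GHom

variable {A B C D : GSMod k} {X : Type} [Finite X]

theorem ext_app {t : ℤ} {f g : GHom t A B}
    (h : ∀ (X : Type) [Finite X] {n m : ℤ} (h : m = n + t) (x : A.obj X n),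
      f.app h x = g.app h x) : f = g := by
  apply GHom.ext
  funext X _ n m e
  exact LinearMap.ext fun x => h X e x

theorem comp_apply {s t r : ℤ} (g : GHom t B C) (f : GHom s A B) (hr : r = s + t) {n l m : ℤ}
    (h : m = n + r) (h1 : l = n + s) (h2 : m = l + t) (x : A.obj X n) :
    (g.comp f hr).app h x = g.app h2 (f.app h1 x) := by
  subst h1; rfl

theorem add_apply {t : ℤ} (f g : GHom t A B) {n m : ℤ} (h : m = n + t) (x : A.obj X n) :
    (f + g).app h x = f.app h x + g.app h x := rfl

theorem id_comp {t : ℤ} (f : GHom t A B) (hr : t = t + 0) : (GHom.id B).comp f hr = f :=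
  ext_app fun X _ n m h x => by
    rw [comp_apply _ _ _ _ h (by simp)]
    exact B.map_refl _

theorem comp_id {t : ℤ} (f : GHom t A B) (hr : t = 0 + t) : f.comp (GHom.id A) hr = f :=
  ext_app fun X _ n m h x => by
    rw [comp_apply (l := n) _ _ _ _ (by simp) h]
    congr 1
    exact A.map_refl _

theorem comp_assoc {s t r st tr str : ℤ} (h : GHom r C D) (g : GHom t B C) (f : GHom s A B)
    (h1 : st = s + t) (h2 : str = st + r) (h3 : tr = t + r) (h4 : str = s + tr) :
    h.comp (g.comp f h1) h2 = (h.comp g h3).comp f h4 :=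
  ext_app fun X _ n m e x => by
    rw [comp_apply (l := n + st) _ _ _ _ rfl (by omega),
      comp_apply (l := n + s) _ _ _ _ rfl (by omega),
      comp_apply (l := n + s) (h.comp g h3) _ _ _ rfl (by omega),
      comp_apply (l := n + st) _ _ _ _ (by omega) (by omega)]

theorem comp_add {s t r : ℤ} (g : GHom t B C) (f f' : GHom s A B) (hr : r = s + t) :
    g.comp (f + f') hr = g.comp f hr + g.comp f' hr :=
  ext_app fun X _ n m e x => by
    rw [add_apply, comp_apply (l := n + s) _ _ _ _ rfl (by omega),
      comp_apply (l := n + s) _ _ _ _ rfl (by omega),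
      comp_apply (l := n + s) _ _ _ _ rfl (by omega), add_apply, map_add]

theorem add_comp {s t r : ℤ} (g g' : GHom t B C) (f : GHom s A B) (hr : r = s + t) :
    (g + g').comp f hr = g.comp f hr + g'.comp f hr :=
  ext_app fun X _ n m e x => by
    rw [add_apply, comp_apply (l := n + s) _ _ _ _ rfl (by omega),
      comp_apply (l := n + s) _ _ _ _ rfl (by omega),
      comp_apply (l := n + s) _ _ _ _ rfl (by omega), add_apply]

end GHom

section compCalculus

variable {A B A' B' A'' B'' C C' : GSMod k}

theorem compMap_comp {s s' r : ℤ} (φ' : GHom s' A' A'') (η' : GHom 0 B' B'') (φ : GHom s A A')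
    (η : GHom 0 B B') (hr : r = s + s') (h0 : (0 : ℤ) = 0 + 0) :
    (compMap φ' η').comp (compMap φ η) hr = compMap (φ'.comp φ hr) (η'.comp η h0) :=
  GHom.ext_app fun X _ n m h x => by
    rw [GHom.comp_apply (l := n + s) _ _ _ _ rfl (by omega)]
    refine comp_ext_apply (compMapObj φ' η' (by omega) ∘ₗ compMapObj φ η rfl)
      (compMapObj (φ'.comp φ hr) (η'.comp η h0) h) (fun i a b => ?_) x
    rw [LinearMap.comp_apply, compMapObj_mk, compMapObj_mk, compMapObj_mk]
    refine compMk_congr (fun _ => rfl) (by simp only; omega) (fun _ => rfl) ?_ fun j => ?_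
    · rw [GHom.comp_apply (l := i.p + s) _ _ _ _ rfl (by omega)]
      exact ((φ'.naturality (Equiv.refl _) _ _ rfl _ _).trans
        (congrArg _ (A'.map_refl _))).symm
    · rw [GHom.comp_apply (l := i.q j) _ _ _ _ (by simp) (by simp)]
      exact (B''.map_refl _).symm

theorem compMap_infComp {s t u s' r : ℤ} (φ' : GHom s' A' A'') (η' : GHom 0 B' B'')
    (φ : GHom s A A') (η : GHom 0 B B') (θ : GHom t B B') (hu : u = s + t) (hr : r = u + s')
    (hs : s + s' = s + s') (h0 : (0 : ℤ) = 0 + 0) (ht : t = t + 0) (hu' : r = s + s' + t) :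
    (compMap φ' η').comp (infComp φ η θ hu) hr =
      infComp (φ'.comp φ hs) (η'.comp η h0) (η'.comp θ ht) hu' :=
  GHom.ext_app fun X _ n m h x => by
    rw [GHom.comp_apply (l := n + u) _ _ _ _ rfl (by omega)]
    refine comp_ext_apply (compMapObj φ' η' (by omega) ∘ₗ infCompObj φ η θ hu rfl)
      (infCompObj (φ'.comp φ hs) (η'.comp η h0) (η'.comp θ ht) hu' h) (fun i a b => ?_) x
    rw [LinearMap.comp_apply, infCompObj_mk, infCompObj_mk, map_sum]
    refine Finset.sum_congr rfl fun j _ => ?_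
    rw [map_smul, compMapObj_mk]
    congr 1
    refine compMk_congr (fun _ => rfl) (by simp only; omega) (fun _ => rfl) ?_ fun l => ?_
    · rw [GHom.comp_apply (l := i.p + s) _ _ _ _ rfl (by omega)]
      exact ((φ'.naturality (Equiv.refl _) _ _ rfl _ _).trans
        (congrArg _ (A'.map_refl _))).symm
    · refine Eq.trans ?_ (B''.map_refl _).symm
      unfold infFactor
      by_cases hl : l = j
      · rw [dif_pos hl, dif_pos hl]
        exact (GHom.comp_apply _ _ _ _ _ _ _).symm
      · rw [dif_neg hl, dif_neg hl]
        exact (GHom.comp_apply _ _ _ _ _ _ _).symm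

theorem infComp_compMap {s t u : ℤ} (φ' : GHom s A' A'') (η' : GHom 0 B' B'')
    (θ' : GHom t B' B'') (φ : GHom 0 A A') (η : GHom 0 B B') (hu : u = s + t) (hr : u = 0 + u)
    (hs : s = 0 + s) (h0 : (0 : ℤ) = 0 + 0) (ht : t = 0 + t) :
    (infComp φ' η' θ' hu).comp (compMap φ η) hr =
      infComp (φ'.comp φ hs) (η'.comp η h0) (θ'.comp η ht) hu :=
  GHom.ext_app fun X _ n m h x => by
    rw [GHom.comp_apply (l := n) _ _ _ _ (by simp) h]
    refine comp_ext_apply (infCompObj φ' η' θ' hu h ∘ₗ compMapObj φ η (by simp))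
      (infCompObj (φ'.comp φ hs) (η'.comp η h0) (θ'.comp η ht) hu h) (fun i a b => ?_) x
    rw [LinearMap.comp_apply, infCompObj_mk, compMapObj_mk, infCompObj_mk]
    refine Finset.sum_congr rfl fun j _ => ?_
    refine congrArg₂ (· • ·) (by simp) ?_
    refine compMk_congr (fun _ => rfl) (by simp only; omega) (fun _ => rfl) ?_ fun l => ?_
    · rw [GHom.comp_apply (l := i.p + 0) _ _ _ _ rfl (by omega)]
      exact ((φ'.naturality (Equiv.refl _) _ _ rfl _ _).trans
        (congrArg _ (A'.map_refl _))).symm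
    · refine Eq.trans ?_ (B''.map_refl _).symm
      unfold infFactor
      by_cases hl : l = j
      · rw [dif_pos hl, dif_pos hl]
        exact (GHom.comp_apply _ _ _ _ _ _ _).symm
      · rw [dif_neg hl, dif_neg hl]
        exact (GHom.comp_apply _ _ _ _ _ _ _).symm

theorem assoc_apply {X : Type} [Finite X] {n : ℤ} (h : n = n + 0) (x : CompObj (A.comp B) C X n) :
    (assoc A B C).app h x = assocObj A B C X n x :=
  (A.comp (B.comp C)).map_refl _

theorem innerMk_map (η : GHom 0 B B') (ζ : GHom 0 C C') {X : Type} [Finite X] {r s : ℕ}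
    (g : X → Fin s) (f : Fin s → Fin r) (i : Fin r) {p p' : ℤ} {q : Fin s → ℤ} (hp : p' = p + 0)
    (hd : p' + ∑ j : {j // f j = i}, q j.1 = p + (∑ j : {j // f j = i}, q j.1) + 0)
    (b : B.obj {j // f j = i} p)
    (c : ∀ y : {j // f j = i}, C.obj {x // g x = y.1} (q y.1)) :
    innerMk g f i (η.app hp b) (fun y => ζ.app (by simp) (c y)) =
      compMapObj η ζ hd (innerMk g f i b c) := by
  obtain rfl : p' = p := by simpa using hp
  unfold innerMk
  rw [compMapObj_mk]
  refine compMk_congr (fun _ => rfl) (by simp) (fun _ => rfl) ?_ fun l => ?_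
  · rw [← η.naturality (ordFin {j // f j = i}).toEquiv hp rfl rfl hp, B'.map_map]
    rfl
  · rw [← ζ.naturality (innerBlock g f i l) (by simp) (by simp) rfl rfl, C'.map_map]
    rfl

theorem assocMk_map (φ : GHom 0 A A') (η : GHom 0 B B') (ζ : GHom 0 C C') {X : Type} [Finite X]
    {n : ℤ} (h : n = n + 0) (J : CompIdx X n) (I : CompIdx (Fin J.r) J.p)
    (a : A.obj (Fin I.r) I.p)
    (b : ∀ i, B.obj {j // I.f j = i} (I.q i)) (c : ∀ j, C.obj {x // J.f x = j} (J.q j)) :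
    assocMk (J.shiftLeft h) (I.shiftLeft rfl) (φ.app rfl a) (fun i => η.app (by simp) (b i))
        (fun j => ζ.app (by simp) (c j)) =
      compMapObj φ (compMap η ζ) h (assocMk J I a b c) := by
  rw [assocMk, assocMk, map_smul, compMapObj_mk]
  refine congrArg (fun z => (-1 : k) ^ assocExp I.f I.q J.q • z) ?_
  refine compMk_congr (fun _ => rfl) rfl (fun _ => rfl) (A'.map_refl _).symm fun i => ?_
  refine Eq.trans ?_ ((B'.comp C').map_refl _).symm
  exact innerMk_map η ζ J.f I.f i (by simp) (by simp) (b i) fun y => c y.1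

theorem compMapObj_mk₂ (φ : GHom 0 A A') (η : GHom 0 B B') (ζ : GHom 0 C C') {X : Type} [Finite X]
    {n : ℤ} (h : n = n + 0) (J : CompIdx X n) (I : CompIdx (Fin J.r) J.p) (a : A.obj (Fin I.r) I.p)
    (b : ∀ i, B.obj {j // I.f j = i} (I.q i)) (c : ∀ j, C.obj {x // J.f x = j} (J.q j)) :
    compMapObj (A := A.comp B) (A' := A'.comp B') (compMap φ η) ζ h
        (compMk (A := A.comp B) (B := C) J (compMk (A := A) (B := B) I a b) c) =
      compMk (A := A'.comp B') (B := C') (J.shiftLeft h)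
        (compMk (A := A') (B := B') (I.shiftLeft (s := 0) rfl) (φ.app rfl a)
          fun i => η.app (by simp) (b i))
        (fun j => ζ.app (by simp) (c j)) := by
  rw [compMapObj_mk (A := A.comp B) (A' := A'.comp B')]
  have := compMapObj_mk φ η (show J.p + 0 = J.p + 0 from rfl) I a b
  exact congrArg (fun z => compMk (A := A'.comp B') (B := C') (J.shiftLeft h) z
    fun j => ζ.app (by simp) (c j)) this

theorem assoc_naturality (φ : GHom 0 A A') (η : GHom 0 B B') (ζ : GHom 0 C C')
    (h0 : (0 : ℤ) = 0 + 0) :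
    (assoc A' B' C').comp (compMap (compMap φ η) ζ) h0 =
      (compMap φ (compMap η ζ)).comp (assoc A B C) h0 :=
  GHom.ext_app fun X _ n m h x => by
    obtain rfl : m = n := by simpa using h
    rw [GHom.comp_apply (l := m) _ _ _ _ (by simp) (by simp),
      GHom.comp_apply (l := m) _ _ _ _ (by simp) (by simp), assoc_apply, assoc_apply]
    refine comp_ext₂ (assocObj A' B' C' X m ∘ₗ compMapObj (compMap φ η) ζ (by simp))
      (compMapObj φ (compMap η ζ) (by simp) ∘ₗ assocObj A B C X m) (fun J I a b c => ?_) x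
    simp only [LinearMap.comp_apply]
    rw [assocObj_mk, compMapObj_mk₂]
    refine (assocObj_mk (J.shiftLeft (by simp)) (I.shiftLeft rfl) _ _ _).trans ?_
    exact assocMk_map φ η ζ (by simp) J I a b c

end compCalculus

/-! ### The unit -/

/-- The unit for the composition product: `k` in degree `0` on one-element sets and `0`
elsewhere. -/
@[reducible] def GSMod.unit (k : Type u) [Field k] : GSMod k where
  obj X _ n := PLift (Nat.card X = 1 ∧ n = 0) → k
  map e _ _ h :=
    { toFun := fun x h' => x ⟨(Nat.card_congr e).trans h'.down.1, h.trans h'.down.2⟩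
      map_add' := fun _ _ => rfl
      map_smul' := fun _ _ => rfl }
  map_refl _ := rfl
  map_map _ _ _ _ _ _ _ _ := rfl

section unit

variable {A : GSMod k} {X X' : Type} [Finite X] [Finite X'] {n m : ℤ}

/-- If there is only one block, it is the whole set. -/
def wholeBlock {Y : Type} (f : X → Y) (j : Y) (h : ∀ y, y = j) : {x // f x = j} ≃ X :=
  Equiv.subtypeUnivEquiv fun x => h (f x)

theorem fin_eq_of_card {r : ℕ} (h : Nat.card (Fin r) = 1) (i j : Fin r) : i = j := by
  have h1 : r = 1 := by simpa using h
  subst h1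
  exact Subsingleton.elim _ _

/-- The number of the only block. -/
def onlyBlock {r : ℕ} (h : Nat.card (Fin r) = 1) : Fin r :=
  ⟨0, by
    have h1 : r = 1 := by simpa using h
    omega⟩

theorem CompIdx.deg_of_card {X : Type} {n : ℤ} (i : CompIdx X n) (h : Nat.card (Fin i.r) = 1 ∧ i.p = 0) (j : Fin i.r) :
    i.q j = n := by
  have h1 : ∑ l, i.q l = i.q j := Finset.sum_eq_single j
    (fun l _ hl => (hl (fin_eq_of_card h.1 l j)).elim) (fun hj => (hj (Finset.mem_univ _)).elim)
  have := i.deg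
  rw [h1, h.2, zero_add] at this
  exact this

/-- The map `b ↦ b₁`, if there is only one block. -/
def onlyFactor (A : GSMod k) (i : CompIdx X n) (h : Nat.card (Fin i.r) = 1 ∧ i.p = 0) :
    (⨂[k] j, A.obj {x // i.f x = j} (i.q j)) →ₗ[k] A.obj X n :=
  PiTensorProduct.lift
    { toFun := fun b => A.map (wholeBlock i.f (onlyBlock h.1) fun y => fin_eq_of_card h.1 y _)
        (i.deg_of_card h _) (b (onlyBlock h.1))
      map_update_add' := fun b j x y => by
        obtain rfl := fin_eq_of_card h.1 j (onlyBlock h.1)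
        simp
      map_update_smul' := fun b j x y => by
        obtain rfl := fin_eq_of_card h.1 j (onlyBlock h.1)
        simp }

open Classical in
/-- The components of the left unitor: `x ⊗ b₁ ↦ x b₁`. -/
def unitCompObj (A : GSMod k) (X : Type) [Finite X] (n : ℤ) :
    CompObj (GSMod.unit k) A X n →ₗ[k] A.obj X n :=
  compLift (A := GSMod.unit k) (B := A) (fun i =>
    if h : Nat.card (Fin i.r) = 1 ∧ i.p = 0 then
      TensorProduct.lift (((LinearMap.lsmul k (A.obj X n)) ∘ₗ
        LinearMap.proj (PLift.up h)).compl₂ (onlyFactor A i h)) else 0) <| by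
    intro i i' σ hi a b a' b' hab
    beta_reduce
    have hc : Nat.card (Fin i.r) = Nat.card (Fin i'.r) := Nat.card_congr σ
    by_cases h : Nat.card (Fin i.r) = 1 ∧ i.p = 0
    · have h' : Nat.card (Fin i'.r) = 1 ∧ i'.p = 0 := by rw [← hc, ← hi.p]; exact h
      rw [dif_pos h, dif_pos h', koszulExp_eq_zero σ _ fun x y hxy =>
        absurd (fin_eq_of_card h.1 x y) hxy.ne, zpow_zero, one_smul]
      change a' ⟨h'⟩ • onlyFactor A i' h' (PiTensorProduct.tprod k b') =
        a ⟨h⟩ • onlyFactor A i h (PiTensorProduct.tprod k b)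
      rw [hab.1]
      congr 1
      refine (PiTensorProduct.lift.tprod b').trans (Eq.trans ?_ (PiTensorProduct.lift.tprod b).symm)
      have key : ∀ y (hy : ∀ z, z = y) (hd : i'.q y = n), y = σ (onlyBlock h.1) →
          A.map (wholeBlock i'.f y hy) hd (b' y) = A.map (wholeBlock i.f (onlyBlock h.1)
            fun y => fin_eq_of_card h.1 y _) (i.deg_of_card h _) (b (onlyBlock h.1)) := by
        rintro y hy hd rfl
        rw [hab.2, A.map_map]
        rfl
      exact key _ _ _ (fin_eq_of_card h'.1 _ _)
    · have h' : ¬ (Nat.card (Fin i'.r) = 1 ∧ i'.p = 0) := by rw [← hc, ← hi.p]; exact h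
      rw [dif_neg h, dif_neg h']
      simp

open Classical in
theorem unitCompObj_mk (i : CompIdx X n) (a : (GSMod.unit k).obj (Fin i.r) i.p)
    (b : ∀ j, A.obj {x // i.f x = j} (i.q j)) :
    unitCompObj A X n (compMk (A := GSMod.unit k) i a b) =
      if h : Nat.card (Fin i.r) = 1 ∧ i.p = 0 then
        a ⟨h⟩ • A.map (wholeBlock i.f (onlyBlock h.1) fun y => fin_eq_of_card h.1 y _)
          (i.deg_of_card h _) (b (onlyBlock h.1)) else 0 := by
  rw [unitCompObj, compLift_mk]
  split_ifs with h
  · exact congrArg (fun z : A.obj X n => a ⟨h⟩ • z) (PiTensorProduct.lift.tprod b)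
  · rfl

/-- The product of the `x_j`, if all blocks have one element. -/
def unitProd (k : Type u) [Field k] (i : CompIdx X n)
    (h : ∀ j, Nat.card {x // i.f x = j} = 1 ∧ i.q j = 0) :
    (⨂[k] j, (GSMod.unit k).obj {x // i.f x = j} (i.q j)) →ₗ[k] k :=
  PiTensorProduct.lift ((MultilinearMap.mkPiAlgebra k (Fin i.r) k).compLinearMap
    fun j => LinearMap.proj (PLift.up (h j)))

/-- If all blocks have one element, the map to the set of blocks is a bijection. -/
def blockEquiv {Y : Type} (f : X → Y) (h : ∀ j, Nat.card {x // f x = j} = 1) : Y ≃ X :=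
  (Equiv.ofBijective f ⟨fun x y hxy => by
    have := (Nat.card_eq_one_iff_unique.1 (h (f y))).1
    exact congrArg Subtype.val (Subsingleton.elim (⟨x, hxy⟩ : {z // f z = f y}) ⟨y, rfl⟩),
    fun j => by
      have := (Nat.card_eq_one_iff_unique.1 (h j)).2
      exact ⟨this.some.1, this.some.2⟩⟩).symm

theorem CompIdx.deg_of_blocks {X : Type} {n : ℤ} (i : CompIdx X n)
    (h : ∀ j, Nat.card {x // i.f x = j} = 1 ∧ i.q j = 0) : i.p = n := by
  have := i.deg
  rw [Finset.sum_eq_zero fun j _ => (h j).2, add_zero] at this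
  exact this

open Classical in
/-- The components of the right unitor: `a ⊗ x₁ ⊗ ⋯ ⊗ x_r ↦ x₁ ⋯ x_r a`. -/
def compUnitObj (A : GSMod k) (X : Type) [Finite X] (n : ℤ) :
    CompObj A (GSMod.unit k) X n →ₗ[k] A.obj X n :=
  compLift (A := A) (B := GSMod.unit k) (fun i =>
    if h : ∀ j, Nat.card {x // i.f x = j} = 1 ∧ i.q j = 0 then
      TensorProduct.lift (((LinearMap.lsmul k (A.obj X n)) ∘ₗ
        unitProd k i h).compl₂
          (A.map (blockEquiv i.f fun j => (h j).1) (i.deg_of_blocks h))).flip else 0) <| by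
    intro i i' σ hi a b a' b' hab
    beta_reduce
    have hc : ∀ j, (Nat.card {x // i.f x = j} = 1 ∧ i.q j = 0) ↔
        (Nat.card {x // i'.f x = σ j} = 1 ∧ i'.q (σ j) = 0) := fun j => by
      rw [Nat.card_congr (blockPerm σ hi.f j), hi.q j]
    by_cases h : ∀ j, Nat.card {x // i.f x = j} = 1 ∧ i.q j = 0
    · have h' : ∀ j, Nat.card {x // i'.f x = j} = 1 ∧ i'.q j = 0 := σ.forall_congr_right.1
        fun j => (hc j).1 (h j)
      have h0 : koszulExp σ i.q = 0 := by simp [koszulExp, (h _).2]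
      rw [dif_pos h, dif_pos h', h0, zpow_zero, one_smul]
      change unitProd k i' h' (PiTensorProduct.tprod k b') •
          A.map (blockEquiv i'.f fun j => (h' j).1) (i'.deg_of_blocks h') a' =
        unitProd k i h (PiTensorProduct.tprod k b) •
          A.map (blockEquiv i.f fun j => (h j).1) (i.deg_of_blocks h) a
      rw [hab.1]
      refine congrArg₂ (· • ·) ?_ ?_
      · refine (PiTensorProduct.lift.tprod b').trans
          (Eq.trans ?_ (PiTensorProduct.lift.tprod b).symm)
        simp only [MultilinearMap.compLinearMap_apply, MultilinearMap.mkPiAlgebra_apply,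
          LinearMap.proj_apply]
        rw [← Equiv.prod_comp σ]
        refine Finset.prod_congr rfl fun j _ => ?_
        rw [hab.2]
        rfl
      · refine (A.map_map (X := Fin i.r) (Y := Fin i'.r) σ _ hi.p _ a).trans ?_
        have key : σ.trans (blockEquiv i'.f fun j => (h' j).1) =
            blockEquiv i.f fun j => (h j).1 := by
          apply Equiv.ext
          intro j
          obtain ⟨x, rfl⟩ := (blockEquiv i.f fun j => (h j).1).symm.surjective j
          rw [Equiv.apply_symm_apply, Equiv.trans_apply, ← Equiv.eq_symm_apply]
          exact (hi.f x).symm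
        simp only [key]
    · have h' : ¬ ∀ j, Nat.card {x // i'.f x = j} = 1 ∧ i'.q j = 0 := fun h' =>
        h fun j => (hc j).2 (h' (σ j))
      rw [dif_neg h, dif_neg h']
      simp

open Classical in
theorem compUnitObj_mk (i : CompIdx X n) (a : A.obj (Fin i.r) i.p)
    (b : ∀ j, (GSMod.unit k).obj {x // i.f x = j} (i.q j)) :
    compUnitObj A X n (compMk (B := GSMod.unit k) i a b) =
      if h : ∀ j, Nat.card {x // i.f x = j} = 1 ∧ i.q j = 0 then
        (∏ j, b j ⟨h j⟩) • A.map (blockEquiv i.f fun j => (h j).1) (i.deg_of_blocks h) a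
      else 0 := by
  rw [compUnitObj, compLift_mk]
  split_ifs with h
  · exact congrArg (fun z : k => z •
      A.map (blockEquiv i.f fun j => (h j).1) (i.deg_of_blocks h) a) (PiTensorProduct.lift.tprod b)
  · rfl

/-- The left unitor `I ∘ A → A`. -/
def unitComp (A : GSMod k) : GHom 0 ((GSMod.unit k).comp A) A where
  app {X} _ n _ h := A.map (Equiv.refl X) (by omega) ∘ₗ unitCompObj A X n
  naturality {X Y} _ _ e n m n' m' h h' hn hm x := by
    refine comp_ext_apply (A := GSMod.unit k)
      (A.map e hm ∘ₗ A.map (Equiv.refl X) (by omega) ∘ₗ unitCompObj A X n)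
      (A.map (Equiv.refl Y) (by omega) ∘ₗ unitCompObj A Y n' ∘ₗ compObjMap _ A e hn)
      (fun i a b => ?_) x
    simp only [LinearMap.comp_apply]
    rw [compObjMap_mk, unitCompObj_mk, unitCompObj_mk]
    by_cases hc : Nat.card (Fin i.r) = 1 ∧ i.p = 0
    · rw [dif_pos hc, dif_pos hc, map_smul, map_smul, map_smul, A.map_map, A.map_map, A.map_map,
        A.map_map]
      rfl
    · rw [dif_neg hc, dif_neg hc]
      simp

/-- The right unitor `A ∘ I → A`. -/
def compUnit (A : GSMod k) : GHom 0 (A.comp (GSMod.unit k)) A where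
  app {X} _ n _ h := A.map (Equiv.refl X) (by omega) ∘ₗ compUnitObj A X n
  naturality {X Y} _ _ e n m n' m' h h' hn hm x := by
    refine comp_ext_apply (B := GSMod.unit k)
      (A.map e hm ∘ₗ A.map (Equiv.refl X) (by omega) ∘ₗ compUnitObj A X n)
      (A.map (Equiv.refl Y) (by omega) ∘ₗ compUnitObj A Y n' ∘ₗ compObjMap A _ e hn)
      (fun i a b => ?_) x
    simp only [LinearMap.comp_apply]
    rw [compObjMap_mk, compUnitObj_mk, compUnitObj_mk]
    have hiff : ∀ j, (Nat.card {x // i.f x = j} = 1 ∧ i.q j = 0) ↔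
        (Nat.card {x // i.f (e.symm x) = j} = 1 ∧ i.q j = 0) := fun j => by
      rw [Nat.card_congr (blockMap e i.f j)]
    by_cases hc : ∀ j, Nat.card {x // i.f x = j} = 1 ∧ i.q j = 0
    · have hc' : ∀ j, Nat.card {x // i.f (e.symm x) = j} = 1 ∧ i.q j = 0 :=
        fun j => (hiff j).1 (hc j)
      rw [dif_pos hc, dif_pos hc', map_smul, map_smul, map_smul, A.map_map, A.map_map, A.map_map]
      refine congrArg₂ (· • ·) rfl ?_
      have key : ((blockEquiv i.f fun j => (hc j).1).trans (Equiv.refl X)).trans e =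
          (blockEquiv (fun x => i.f (e.symm x)) fun j => (hc' j).1).trans (Equiv.refl Y) := by
        apply Equiv.ext
        intro j
        obtain ⟨x, rfl⟩ := (blockEquiv i.f fun j => (hc j).1).symm.surjective j
        simp only [Equiv.trans_apply, Equiv.apply_symm_apply, Equiv.refl_apply]
        rw [← Equiv.symm_apply_eq]
        change i.f (e.symm (e x)) = i.f x
        rw [e.symm_apply_apply]
      simp only [← key]
      rfl
    · have hc' : ¬ ∀ j, Nat.card {x // i.f (e.symm x) = j} = 1 ∧ i.q j = 0 :=
        fun h => hc fun j => (hiff j).2 (h j)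
      rw [dif_neg hc, dif_neg hc']
      simp

end unit

/-! ### Differential graded `𝕊`-modules -/

/-- A graded `𝕊`-module with an endomorphism `d` of degree `-1`. -/
structure DiffSMod (k : Type u) [Field k] extends GSMod k where
  d : GHom (-1) toGSMod toGSMod

/-- A differential graded `𝕊`-module. -/
structure DGSMod (k : Type u) [Field k] extends DiffSMod k where
  d_d : d.comp d = (0 : GHom (-2) toGSMod toGSMod)

/-- An isomorphism: a natural isomorphism of degree `0` that commutes with the endomorphisms
`d`. -/
structure DiffSMod.Iso (A B : DiffSMod k) where
  hom : GHom 0 A.toGSMod B.toGSMod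
  inv : GHom 0 B.toGSMod A.toGSMod
  hom_inv : inv.comp hom = GHom.id A.toGSMod
  inv_hom : hom.comp inv = GHom.id B.toGSMod
  hom_d : (hom.comp A.d : GHom (-1) A.toGSMod B.toGSMod) = B.d.comp hom

/-- The differential `d_A ∘ id + id ∘' d_B` of `A ∘ B`. -/
def compD (A B : DiffSMod k) :
    GHom (-1) (A.toGSMod.comp B.toGSMod) (A.toGSMod.comp B.toGSMod) :=
  compMap A.d (GHom.id B.toGSMod) + infComp (GHom.id A.toGSMod) (GHom.id B.toGSMod) B.d (by omega)

section

variable {A B C D : GSMod k} {u : ℤ}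

theorem GHom.assoc₁ (h : GHom u C D) (g : GHom 0 B C) (f : GHom 0 A B) :
    (h.comp (g.comp f : GHom 0 A C) : GHom u A D) = (h.comp g : GHom u B D).comp f :=
  GHom.comp_assoc _ _ _ _ _ _ _

theorem GHom.assoc₂ (h : GHom 0 C D) (g : GHom u B C) (f : GHom 0 A B) :
    (h.comp (g.comp f : GHom u A C) : GHom u A D) = (h.comp g : GHom u B D).comp f :=
  GHom.comp_assoc _ _ _ _ _ _ _

theorem GHom.assoc₃ (h : GHom 0 C D) (g : GHom 0 B C) (f : GHom u A B) :
    (h.comp (g.comp f : GHom u A C) : GHom u A D) = (h.comp g : GHom 0 B D).comp f :=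
  GHom.comp_assoc _ _ _ _ _ _ _

end

theorem compMap_comp₀ {A B A' B' A'' B'' : GSMod k} (φ' : GHom 0 A' A'') (η' : GHom 0 B' B'')
    (φ : GHom 0 A A') (η : GHom 0 B B') :
    ((compMap φ' η').comp (compMap φ η) : GHom 0 (A.comp B) (A''.comp B'')) =
      compMap (φ'.comp φ) (η'.comp η) :=
  compMap_comp _ _ _ _ _ _

theorem compD_naturality {A B A' B' : DiffSMod k} (φ : GHom 0 A.toGSMod A'.toGSMod)
    (η : GHom 0 B.toGSMod B'.toGSMod)
    (hφ : (φ.comp A.d : GHom (-1) A.toGSMod A'.toGSMod) = A'.d.comp φ)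
    (hη : (η.comp B.d : GHom (-1) B.toGSMod B'.toGSMod) = B'.d.comp η) :
    ((compMap φ η).comp (compD A B) :
      GHom (-1) (A.toGSMod.comp B.toGSMod) (A'.toGSMod.comp B'.toGSMod)) =
      (compD A' B').comp (compMap φ η) := by
  rw [compD, compD, GHom.comp_add, GHom.add_comp, compMap_comp _ _ _ _ _ (by omega),
    compMap_comp _ _ _ _ _ (by omega),
    compMap_infComp _ _ _ _ _ _ _ rfl (by omega) (by omega) (by omega),
    infComp_compMap _ _ _ _ _ _ _ (by omega) (by omega) (by omega),
    hφ, hη]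
  simp only [GHom.id_comp, GHom.comp_id]

/-! ### Operads and cooperads -/

/-- An operad: a monoid for the composition product of differential graded `𝕊`-modules. -/
structure Operad (k : Type u) [Field k] extends DGSMod k where
  mul : GHom 0 (toGSMod.comp toGSMod) toGSMod
  one : GHom 0 (GSMod.unit k) toGSMod
  mul_d : (mul.comp (compD toDiffSMod toDiffSMod) :
    GHom (-1) (toGSMod.comp toGSMod) toGSMod) = d.comp mul
  one_d : (d.comp one : GHom (-1) (GSMod.unit k) toGSMod) = 0
  mul_assoc : (mul.comp (compMap mul (GHom.id toGSMod)) :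
      GHom 0 ((toGSMod.comp toGSMod).comp toGSMod) toGSMod) =
    (mul.comp (compMap (GHom.id toGSMod) mul) :
      GHom 0 (toGSMod.comp (toGSMod.comp toGSMod)) toGSMod).comp (assoc _ _ _)
  one_mul : mul.comp (compMap one (GHom.id toGSMod)) = unitComp toGSMod
  mul_one : mul.comp (compMap (GHom.id toGSMod) one) = compUnit toGSMod

/-- A morphism of operads. -/
structure OperadHom (O P : Operad k) where
  hom : GHom 0 O.toGSMod P.toGSMod
  hom_d : (hom.comp O.d : GHom (-1) O.toGSMod P.toGSMod) = P.d.comp hom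
  hom_mul : (hom.comp O.mul : GHom 0 (O.toGSMod.comp O.toGSMod) P.toGSMod) =
    P.mul.comp (compMap hom hom)
  hom_one : hom.comp O.one = P.one

/-- A cooperad: a comonoid for the composition product of differential graded `𝕊`-modules. -/
structure Cooperad (k : Type u) [Field k] extends DGSMod k where
  comul : GHom 0 toGSMod (toGSMod.comp toGSMod)
  counit : GHom 0 toGSMod (GSMod.unit k)
  comul_d : (comul.comp d : GHom (-1) toGSMod (toGSMod.comp toGSMod)) =
    (compD toDiffSMod toDiffSMod).comp comul
  counit_d : (counit.comp d : GHom (-1) toGSMod (GSMod.unit k)) = 0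
  comul_assoc : (assoc _ _ _).comp ((compMap comul (GHom.id toGSMod)).comp comul :
      GHom 0 toGSMod ((toGSMod.comp toGSMod).comp toGSMod)) =
    ((compMap (GHom.id toGSMod) comul).comp comul :
      GHom 0 toGSMod (toGSMod.comp (toGSMod.comp toGSMod)))
  counit_comul : (unitComp toGSMod).comp ((compMap counit (GHom.id toGSMod)).comp comul :
    GHom 0 toGSMod ((GSMod.unit k).comp toGSMod)) = GHom.id toGSMod
  comul_counit : (compUnit toGSMod).comp ((compMap (GHom.id toGSMod) counit).comp comul :
    GHom 0 toGSMod (toGSMod.comp (GSMod.unit k))) = GHom.id toGSMod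

/-- A morphism of cooperads. -/
structure CooperadHom (C D : Cooperad k) where
  hom : GHom 0 C.toGSMod D.toGSMod
  hom_d : (hom.comp C.d : GHom (-1) C.toGSMod D.toGSMod) = D.d.comp hom
  hom_comul : (D.comul.comp hom : GHom 0 C.toGSMod (D.toGSMod.comp D.toGSMod)) =
    (compMap hom hom).comp C.comul
  hom_counit : D.counit.comp hom = C.counit

/-- A right comodule over a cooperad `C`. -/
structure RightComodule (C : Cooperad k) extends DGSMod k where
  coact : GHom 0 toGSMod (toGSMod.comp C.toGSMod)
  coact_d : (coact.comp d : GHom (-1) toGSMod (toGSMod.comp C.toGSMod)) =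
    (compD toDiffSMod C.toDiffSMod).comp coact
  coact_assoc : (assoc _ _ _).comp ((compMap coact (GHom.id C.toGSMod)).comp coact :
      GHom 0 toGSMod ((toGSMod.comp C.toGSMod).comp C.toGSMod)) =
    ((compMap (GHom.id toGSMod) C.comul).comp coact :
      GHom 0 toGSMod (toGSMod.comp (C.toGSMod.comp C.toGSMod)))
  coact_counit : (compUnit toGSMod).comp ((compMap (GHom.id toGSMod) C.counit).comp coact :
    GHom 0 toGSMod (toGSMod.comp (GSMod.unit k))) = GHom.id toGSMod

/-- An `𝕊`-module-algebra over an operad `O`: a differential graded `𝕊`-module `A` with an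
associative action `O ∘ A → A`. Unital actions are a special case. -/
structure SModAlg (O : Operad k) extends DGSMod k where
  act : GHom 0 (O.toGSMod.comp toGSMod) toGSMod
  act_d : (act.comp (compD O.toDiffSMod toDiffSMod) :
    GHom (-1) (O.toGSMod.comp toGSMod) toGSMod) = d.comp act
  act_assoc : (act.comp (compMap O.mul (GHom.id toGSMod)) :
      GHom 0 ((O.toGSMod.comp O.toGSMod).comp toGSMod) toGSMod) =
    (act.comp (compMap (GHom.id O.toGSMod) act) :
      GHom 0 (O.toGSMod.comp (O.toGSMod.comp toGSMod)) toGSMod).comp (assoc _ _ _)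

/-! ### Restriction along morphisms -/

/-- The `𝕊`-module-algebra `f^* A` over `O` based on `A`. -/
@[reducible] def SModAlg.pullback {O P : Operad k} (f : OperadHom O P) (A : SModAlg P) : SModAlg O where
  toDGSMod := A.toDGSMod
  act := A.act.comp (compMap f.hom (GHom.id A.toGSMod))
  act_d := by
    rw [← GHom.assoc₃, compD_naturality _ _ f.hom_d (by rw [GHom.id_comp, GHom.comp_id]),
      GHom.assoc₂, A.act_d, ← GHom.assoc₁]
  act_assoc := by
    have h : (0 : ℤ) = 0 + 0 := rfl
    have e1 : compMap (f.hom.comp O.mul h) ((GHom.id A.toGSMod).comp (GHom.id A.toGSMod) h) =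
        (compMap P.mul (GHom.id A.toGSMod)).comp
          (compMap (compMap f.hom f.hom) (GHom.id A.toGSMod)) h := by
      rw [compMap_comp₀, f.hom_mul]
    have e2 : (compMap f.hom (GHom.id A.toGSMod)).comp (compMap (GHom.id O.toGSMod)
          (A.act.comp (compMap f.hom (GHom.id A.toGSMod)) h)) h =
        (compMap (GHom.id P.toGSMod) A.act).comp
          (compMap f.hom (compMap f.hom (GHom.id A.toGSMod))) h := by
      rw [compMap_comp₀, compMap_comp₀]
      simp only [GHom.id_comp, GHom.comp_id]
    rw [← GHom.assoc₁, compMap_comp₀, e1, GHom.assoc₁, A.act_assoc, ← GHom.assoc₁,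
      assoc_naturality, GHom.assoc₁, ← GHom.assoc₁ A.act, ← e2, GHom.assoc₁]

/-- The right `D`-comodule `g^* M` based on `M`. -/
@[reducible] def RightComodule.pushforward {C D : Cooperad k} (g : CooperadHom C D) (M : RightComodule C) :
    RightComodule D where
  toDGSMod := M.toDGSMod
  coact := (compMap (GHom.id M.toGSMod) g.hom).comp M.coact
  coact_d := by
    rw [← GHom.assoc₃, M.coact_d, GHom.assoc₂,
      compD_naturality _ _ (by rw [GHom.id_comp, GHom.comp_id]) g.hom_d, ← GHom.assoc₁]
  coact_assoc := by
    have h : (0 : ℤ) = 0 + 0 := rfl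
    have e1 : (compMap ((compMap (GHom.id M.toGSMod) g.hom).comp M.coact h)
          (GHom.id D.toGSMod)).comp (compMap (GHom.id M.toGSMod) g.hom) h =
        (compMap (compMap (GHom.id M.toGSMod) g.hom) g.hom).comp
          (compMap M.coact (GHom.id C.toGSMod)) h := by
      rw [compMap_comp₀, compMap_comp₀]
      simp only [GHom.id_comp, GHom.comp_id]
    have e2 : (compMap (GHom.id M.toGSMod) (compMap g.hom g.hom)).comp
          (compMap (GHom.id M.toGSMod) C.comul) h =
        (compMap (GHom.id M.toGSMod) D.comul).comp (compMap (GHom.id M.toGSMod) g.hom) h := by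
      rw [compMap_comp₀, compMap_comp₀, g.hom_comul]
    rw [GHom.assoc₁ _ _ M.coact, e1, ← GHom.assoc₁ _ _ M.coact, GHom.assoc₁, assoc_naturality,
      ← GHom.assoc₁, M.coact_assoc, GHom.assoc₁, e2, ← GHom.assoc₁]
  coact_counit := by
    rw [GHom.assoc₁ _ _ M.coact, compMap_comp₀, g.hom_counit, GHom.id_comp, M.coact_counit]

/-! ### Twisting morphisms and twisted composites -/

/-- The convolution square `κ ∗ κ`: the composite
`C → C ∘ C → O ∘ O → O`, where the map in the middle applies `κ` to the first factor and to one of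
the other factors, and the counit followed by the unit to all the remaining ones. -/
def convSq {C : Cooperad k} {O : Operad k} (κ : GHom (-1) C.toGSMod O.toGSMod) :
    GHom (-2) C.toGSMod O.toGSMod :=
  O.mul.comp ((infComp κ (O.one.comp C.counit) κ (u := -2) (by omega)).comp C.comul :
    GHom (-2) C.toGSMod (O.toGSMod.comp O.toGSMod))

/-- An operadic twisting morphism. -/
structure TwistingMorphism (C : Cooperad k) (O : Operad k) where
  hom : GHom (-1) C.toGSMod O.toGSMod
  maurer_cartan : O.d.comp hom + hom.comp C.d + convSq hom = 0

/-- The twisting term `d_κ` on `M ∘ A`: the composite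
`M ∘ A → (M ∘ C) ∘ A ≅ M ∘ (C ∘ A) → M ∘ A`, where the last map applies `κ` followed by the action
`O ∘ A → A` to one of the factors in `C ∘ A`, and the counit of `C` to all the other ones. -/
def twistD {C : Cooperad k} {O : Operad k} (κ : TwistingMorphism C O) (M : RightComodule C)
    (A : SModAlg O) :
    GHom (-1) (M.toGSMod.comp A.toGSMod) (M.toGSMod.comp A.toGSMod) :=
  (infComp (GHom.id M.toGSMod)
      ((unitComp A.toGSMod).comp (compMap C.counit (GHom.id A.toGSMod)) :
        GHom 0 (C.toGSMod.comp A.toGSMod) A.toGSMod)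
      (A.act.comp (compMap κ.hom (GHom.id A.toGSMod)) :
        GHom (-1) (C.toGSMod.comp A.toGSMod) A.toGSMod) (u := -1) (by omega)).comp
    ((assoc M.toGSMod C.toGSMod A.toGSMod).comp (compMap M.coact (GHom.id A.toGSMod)) :
      GHom 0 (M.toGSMod.comp A.toGSMod) (M.toGSMod.comp (C.toGSMod.comp A.toGSMod)))

/-- The twisted composite `M ∘_κ A`, that is, `M ∘ A` with `d_κ + d_{M ∘ A}`. -/
def twistedComposite {C : Cooperad k} {O : Operad k} (κ : TwistingMorphism C O)
    (M : RightComodule C) (A : SModAlg O) : DiffSMod k where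
  toGSMod := M.toGSMod.comp A.toGSMod
  d := twistD κ M A + compD M.toDiffSMod A.toDiffSMod

end

/-! Restriction along `f` changes only the action on `A`, and restriction along `g` changes only the
coaction on `M`. The two twisted composites therefore live on the same graded `𝕊`-module `M ∘ A` and
have the same untwisted differential `compD`, so everything comes down to the equality of the two
twisting terms, as maps and not merely up to isomorphism.

On a generator, a twisting term coacts on the factor in `M`, attaches the resulting cooperadic
factors `c₁, …, c_r` to the groups of factors in `A` below them, lets one `c_j` act through the
twisting morphism and kills the others by the counit. With `g^* M` each `c_i` is replaced by `g
c_i`. The selected factor then acts on `A` through `κ' (g c_j)`, whereas with `f^* A` it acts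
through `f (κ c_j)`; these agree by the commutative square `hsq`. A remaining factor contributes the
counit of `D` at `g c_i`, which is the counit of `C` at `c_i` because `g` is a morphism of
cooperads. Since `f` and `g` have degree 0, the Koszul signs on the two sides are the same.

Without elements, the argument moves `g` from the coaction through the rebracketing `(M ∘ D) ∘ A ≅ M
∘ (D ∘ A)` and into the two maps `η` and `θ` from which the twisting term is built. Naturality of
the associator (`assoc_naturality`) gives the first move. The second is `infComp_compMap`:
precomposing an infinitesimal composite `φ ∘ (η; θ)` with a composite of degree 0 morphisms
precomposes each of `φ`, `η` and `θ`. Functoriality of `∘` (`compMap_comp`, and `compMap_comp₀` in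
degree 0) then identifies the new `η` and `θ` with those of the other side. -/

/-! ### Change of operad and cooperad in the twisted composite -/

/-- The twisting terms of `M ∘_κ f^* A` and `g^* M ∘_κ' A` agree. -/
theorem twistD_pullback_pushforward {k : Type u} [Field k] {O P : Operad k} {C D : Cooperad k}
    (f : OperadHom O P) (g : CooperadHom C D)
    (κ : TwistingMorphism C O) (κ' : TwistingMorphism D P)
    (hsq : (f.hom.comp κ.hom : GHom (-1) C.toGSMod P.toGSMod) = κ'.hom.comp g.hom)
    (M : RightComodule C) (A : SModAlg P) :
    twistD κ M (A.pullback f) = twistD κ' (M.pushforward g) A := by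
  -- Degree bookkeeping: the degree of a composite is a parameter subject to an equation. Passing
  -- this equation explicitly fixes the degree of the nested composites below as 0.
  have h0 : (0 : ℤ) = 0 + 0 := rfl
  -- The coaction side: `g` sits inside the left bracket of `(M ∘ D) ∘ A`, and naturality of the
  -- associator carries it to the middle factor of `M ∘ (D ∘ A)`. What is left on the right is
  -- exactly the first half of the twisting term for `C` and `M`, so that `g` can next be absorbed
  -- by the infinitesimal composite.
  have hcoact : (assoc M.toGSMod D.toGSMod A.toGSMod).comp
        (compMap ((compMap (GHom.id M.toGSMod) g.hom).comp M.coact h0) (GHom.id A.toGSMod)) h0 =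
      (compMap (GHom.id M.toGSMod) (compMap g.hom (GHom.id A.toGSMod))).comp
        ((assoc M.toGSMod C.toGSMod A.toGSMod).comp
          (compMap M.coact (GHom.id A.toGSMod)) h0) h0 := by
    -- The right-hand side is transformed into the left: once `g` has been pulled back through the
    -- associator, it and the coaction of `M` are both applied in the first slot of `∘ A`, and
    -- functoriality merges them into the coaction of `g^* M`.
    rw [GHom.assoc₁, ← assoc_naturality, ← GHom.assoc₁, compMap_comp₀, GHom.id_comp]
  -- The map `η` applied to the unselected factors: precomposing the one for `D` with `g` gives the
  -- one for `C`, because `g` preserves counits.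
  have hcounit : ((unitComp A.toGSMod).comp (compMap D.counit (GHom.id A.toGSMod)) h0).comp
        (compMap g.hom (GHom.id A.toGSMod)) h0 =
      (unitComp A.toGSMod).comp (compMap C.counit (GHom.id A.toGSMod)) h0 := by
    rw [← GHom.assoc₁, compMap_comp₀, g.hom_counit, GHom.id_comp]
  -- The map `θ` applied to the selected factor: this is the only place where the commutative square
  -- of twisting morphisms enters. The right-hand side is bracketed so that its first composite is
  -- literally the action of `f^* A`.
  have hact : (A.act.comp (compMap κ'.hom (GHom.id A.toGSMod)) :
        GHom (-1) (D.toGSMod.comp A.toGSMod) A.toGSMod).comp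
        (compMap g.hom (GHom.id A.toGSMod)) (by omega) =
      ((A.act.comp (compMap f.hom (GHom.id A.toGSMod)) h0).comp
        (compMap κ.hom (GHom.id A.toGSMod)) :
        GHom (-1) (C.toGSMod.comp A.toGSMod) A.toGSMod) := by
    -- Both sides are brought to the form action of `A` after one composite with the identity of
    -- `A`. The first slots are then `κ' g` and `f κ`. No sign appears, because the degree -1
    -- morphism stands in the leftmost slot and the second slots all have degree 0.
    rw [← GHom.assoc₂, ← GHom.assoc₃, compMap_comp _ _ _ _ _ h0, compMap_comp _ _ _ _ _ h0, hsq]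
  unfold twistD
  -- Only the side of `g^* M` and `κ'` is rewritten. The explicit argument of `GHom.assoc₁` singles
  -- out the composite containing `g`, since the other twisting term has the same outer shape.
  -- Regrouping puts `id ∘ (g ∘ id)` directly before the infinitesimal composite, where
  -- `infComp_compMap` distributes it: `η` and `θ` each absorb `g ∘ id`, which `hcounit` and `hact`
  -- evaluate, and the factor in `M` meets only a composite of identities.
  rw [hcoact, GHom.assoc₁ _ (compMap (GHom.id M.toGSMod) (compMap g.hom (GHom.id A.toGSMod))),
    infComp_compMap _ _ _ _ _ _ (by omega) (by omega) (by omega) (by omega), hcounit, hact,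
    GHom.id_comp]

/-- Both underlying graded `𝕊`-modules unfold to `M ∘ A`, so the identity has the required source
and target with no transport. Naturality and invertibility are then automatic, and commuting with
the degree -1 endomorphisms means that these endomorphisms are equal. -/
theorem mainTheorem9 {k : Type u} [Field k] {O P : Operad k} {C D : Cooperad k}
    (f : OperadHom O P) (g : CooperadHom C D)
    (κ : TwistingMorphism C O) (κ' : TwistingMorphism D P)
    (hsq : (f.hom.comp κ.hom : GHom (-1) C.toGSMod P.toGSMod) = κ'.hom.comp g.hom)
    (M : RightComodule C) (A : SModAlg P) :
    ∃ e : DiffSMod.Iso (twistedComposite κ M (A.pullback f))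
        (twistedComposite κ' (M.pushforward g) A),
      e.hom = GHom.id (M.toGSMod.comp A.toGSMod) := by
  -- The summand `compD` depends only on the differentials of `M` and `A`, which `f^*` and `g^*`
  -- leave in place, so it is the same on both sides by definition. Adding it to the equality of
  -- twisting terms gives the equality of the full endomorphisms.
  have hd : (twistedComposite κ M (A.pullback f)).d =
      (twistedComposite κ' (M.pushforward g) A).d :=
    congrArg (· + compD M.toDiffSMod A.toDiffSMod)
      (twistD_pullback_pushforward f g κ κ' hsq M A)
  refine ⟨{ hom := GHom.id (M.toGSMod.comp A.toGSMod)
            inv := GHom.id (M.toGSMod.comp A.toGSMod)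
            hom_inv := GHom.id_comp _ _
            inv_hom := GHom.id_comp _ _
            hom_d := ?_ }, rfl⟩
  -- Cancelling the identities turns compatibility with the endomorphisms into `hd`.
  exact (GHom.id_comp _ _).trans (hd.trans (GHom.comp_id _ _).symm)
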